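/- Let $a<b$ be real and $\nu\in\mathbb C$. For $N\ge 1$ let $x_j=a+\frac jN(b-a)$ and let $\chi_j=\sqrt{N/(b-a)}\,\mathbb I_{[x_{j-1},x_j)}$, $1\le j\le N$, be the normalized indicator functions in $L^2([a,b))$. Put $Z^N(j,k)=-\bar\nu\,|\chi_j\rangle\langle\chi_k|+\nu\,|\chi_k\rangle\langle\chi_j|$ and $$W_N=\prod_{1\le j<k\le N}\Bigl(I+\tfrac{b-a}{N}Z^N(j,k)\Bigr):=\prod_{j=1}^{N-1}\Bigl[\prod_{k=j+1}^{N}\bigl(I+\tfrac{b-a}{N}Z^N(j,k)\bigr)\Bigr],$$ a bounded operator on $L^2([a,b))$, where in every product the factors are written from left to right in order of increasing index. For $s\ge1$ let $\Pi_s$ be the set of paths $\pi\in\{0,1\}^s$ with no two consecutive zeros, and let $\epsilon(\pi)=\sum_i\pi(i)$. For $\pi\in\Pi_s$ let $\Omega_\pi$ be the set of arrays $(p_{i,1},p_{i,2})_{1\le i\le s}$ with $p_{i,1}<p_{i,2}$ for all $i$ and, for $1\le i\le s-1$, $p_{i,1}<p_{i+1,1}<p_{i,2}=p_{i+1,2}$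 if $(\pi(i),\pi(i+1))=(1,0)$; $p_{i,1}<p_{i,2}=p_{i+1,1}<p_{i+1,2}$ if $(\pi(i),\pi(i+1))=(1,1)$; $p_{i,1}=p_{i+1,1}<p_{i,2}<p_{i+1,2}$ if $(\pi(i),\pi(i+1))=(0,1)$. The $s+1$ essential coordinates of $p\in\Omega_\pi$ are $e_0,\dots,e_s$, where $e_0=p_{1,1}$ if $\pi(1)=1$, $e_0=p_{1,2}$ if $\pi(1)=0$, and for $1\le i\le s$, $e_i=p_{i,2}$ if $\pi(i)=1$, $e_i=p_{i,1}$ if $\pi(i)=0$; put $j_p=e_0$, $k_p=e_s$. A linear extension $B$ of $\pi$ is a strict total ordering (without repetition) of the essential coordinates that is compatible with the relations defining $\Omega_\pi$; its rank is $(r_B,r_B')$, where $r_B$ is the number of essential coordinates less than $j_p$ and $r'_B$ the number of those greater than $k_p$. For $m,n,p,q\ge0$ let $D_{m,n,p;q}$ (respectively $E_{m,n,p;q}$) be the number of pairs $(\pi,B)$ with $\pi\in\Pi_{m+n+p+1}$, $\epsilon(\pi)=q$, and $B$ a linear extension of $\pi$ of rank $(m,p)$ (respectively $(m+n+1,n+p+1)$).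 Let $[m,n,p](x,y)=\frac{(x-a)^m}{m!}\frac{(y-x)^n}{n!}\frac{(b-y)^p}{p!}$, $[m,n,p]^\dagger(x,y)=[m,n,p](y,x)$, and for $s\ge1$ $$f_s=\sum_{m+n+p=s-1}\sum_{q=0}^{s}D_{m,n,p;q}(-\bar\nu)^q\nu^{s-q}[m,n,p],\qquad g_s=\sum_{m+n+p=s-1}\sum_{q=0}^{s}E_{m,n,p;q}(-\bar\nu)^q\nu^{s-q}[m,n,p]^\dagger .$$ Theorem. For every $s\ge1$ there is a bounded integral operator $w_s$ on $L^2([a,b))$ with kernel $f_s(x,y)\,\mathbb I_{a\le x<y<b}+g_s(x,y)\,\mathbb I_{a\le y<x<b}$; the series $\sum_{s\ge1}w_s$ converges in operator norm, and $W_N$ converges weakly, as $N\to\infty$, to $$W=I+\sum_{s\ge1}w_s,$$ that is, $\langle f,W_Ng\rangle\to\langle f,Wg\rangle$ for all $f,g\in L^2([a,b))$. -/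

import Mathlib

open MeasureTheory Set Filter Topology

noncomputable section

namespace CausalProduct

/-! ### The discrete double product -/

/-- The Hilbert space `L²([a,b))` of complex functions, with Lebesgue measure. -/
abbrev L2 (a b : ℝ) : Type := Lp ℂ 2 (volume.restrict (Ico a b))

/-- The point `x_j = a + (j / N) (b - a)` of the equipartition of `[a,b)` into `N` intervals. -/
def gridPoint (a b : ℝ) (N j : ℕ) : ℝ := a + (j : ℝ) / (N : ℝ) * (b - a)

/-- The normalized indicator function `χ_j` of `[x_{j-1}, x_j)` (used for `1 ≤ j ≤ N`). -/
def chi (a b : ℝ) (N j : ℕ) : L2 a b :=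
  indicatorConstLp 2 (measurableSet_Ico (a := gridPoint a b N (j - 1)) (b := gridPoint a b N j))
    (measure_ne_top (volume.restrict (Ico a b)) _)
    ((Real.sqrt ((N : ℝ) / (b - a)) : ℝ) : ℂ)

/-- `Z^N(j,k) = -ν̄ |χ_j⟩⟨χ_k| + ν |χ_k⟩⟨χ_j|`. -/
def Z (a b : ℝ) (ν : ℂ) (N j k : ℕ) : L2 a b →L[ℂ] L2 a b :=
  (-(starRingEnd ℂ) ν) • InnerProductSpace.rankOne ℂ (chi a b N j) (chi a b N k)
    + ν • InnerProductSpace.rankOne ℂ (chi a b N k) (chi a b N j)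

/-- The ordered double product `∏_{j=1}^{N-1} [∏_{k=j+1}^{N} x_{j,k}]`; in both products
the factors stand from left to right in the order of increasing index. -/
def orderedDoubleProd {A : Type*} [Monoid A] (N : ℕ) (x : ℕ → ℕ → A) : A :=
  ((List.Ico 1 N).map fun j => ((List.Ico (j + 1) (N + 1)).map fun k => x j k).prod).prod

/-- The operator `W_N = ∏_{1 ≤ j < k ≤ N} (I + ((b-a)/N) Z^N(j,k))` on `L²([a,b))`. -/
def WN (a b : ℝ) (ν : ℂ) (N : ℕ) : L2 a b →L[ℂ] L2 a b :=
  orderedDoubleProd N fun j k => 1 + (((b - a) / (N : ℝ) : ℝ) : ℂ) • Z a b ν N j k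

/-! ### Lattice paths, their orderings, and linear extensions

A path with `s = t + 1` vertices (of length `t`) is `π : Fin (t + 1) → Bool`, where `true` is an
upper vertex and `false` a lower vertex. -/

/-- A lattice path has no two consecutive lower vertices. -/
def IsPath {t : ℕ} (π : Fin (t + 1) → Bool) : Prop :=
  ∀ i : Fin t, ¬ (π i.castSucc = false ∧ π i.succ = false)

/-- The number `ε(π)` of upper vertices of `π`. -/
def upperCount {t : ℕ} (π : Fin (t + 1) → Bool) : ℕ :=
  (Finset.univ.filter fun i => π i = true).card

/-- The relation between two consecutive pairs `p = (p_{i,1}, p_{i,2})` and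
`p' = (p_{i+1,1}, p_{i+1,2})` that is prescribed by the corresponding edge of the path. -/
def EdgeRel {α : Type*} [LinearOrder α] : Bool → Bool → α × α → α × α → Prop
  | true, false, p, p' => p.1 < p'.1 ∧ p'.1 < p.2 ∧ p.2 = p'.2
  | true, true, p, p' => p.1 < p.2 ∧ p.2 = p'.1 ∧ p'.1 < p'.2
  | false, true, p, p' => p.1 = p'.1 ∧ p'.1 < p.2 ∧ p.2 < p'.2
  | false, false, _, _ => False

/-- `p ∈ Ω_π`: the array of pairs `p` has `p_{i,1} < p_{i,2}` for all `i`, and its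
consecutive pairs are related as the path `π` prescribes. -/
def MemOmega {α : Type*} [LinearOrder α] {t : ℕ} (π : Fin (t + 1) → Bool)
    (p : Fin (t + 1) → α × α) : Prop :=
  (∀ i, (p i).1 < (p i).2) ∧
    ∀ i : Fin t, EdgeRel (π i.castSucc) (π i.succ) (p i.castSucc) (p i.succ)

/-- The `s + 1 = t + 2` essential coordinates of an array `p` with path `π`. The weight
of a vertex is a multiple of `|p_{i,1}⟩⟨p_{i,2}|` (upper) or of `|p_{i,2}⟩⟨p_{i,1}|` (lower).
The first essential coordinate `j_p` is the ket label of the first vertex; the others are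
the bra labels of the successive vertices, the last one being `k_p`. -/
def essCoord {α : Type*} {t : ℕ} (π : Fin (t + 1) → Bool) (p : Fin (t + 1) → α × α) :
    Fin (t + 2) → α :=
  Fin.cons (if π 0 then (p 0).1 else (p 0).2) fun i => if π i then (p i).2 else (p i).1

/-- A linear extension of the partial ordering of the essential coordinates given by `π`: a
strict total ordering without repetition. It is encoded by the array whose entries are the
positions `0, …, t + 1` of the coordinates in the total ordering. -/
def IsLinearExtension {t : ℕ} (π : Fin (t + 1) → Bool)
    (p : Fin (t + 1) → Fin (t + 2) × Fin (t + 2)) : Prop :=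
  MemOmega π p ∧ Function.Injective (essCoord π p)

/-- First entry `r_B` of the rank: the number of essential coordinates less than `j_p`. -/
def rankLeft {t : ℕ} (π : Fin (t + 1) → Bool)
    (p : Fin (t + 1) → Fin (t + 2) × Fin (t + 2)) : ℕ :=
  (Finset.univ.filter fun i => essCoord π p i < essCoord π p 0).card

/-- Second entry `r'_B` of the rank: the number of essential coordinates greater than `k_p`. -/
def rankRight {t : ℕ} (π : Fin (t + 1) → Bool)
    (p : Fin (t + 1) → Fin (t + 2) × Fin (t + 2)) : ℕ :=
  (Finset.univ.filter fun i => essCoord π p (Fin.last (t + 1)) < essCoord π p i).card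

/-- The number of pairs `(π, B)` where `π` is a path of length `t` with `q` upper vertices and
`B` is a linear extension of `π` of rank `(r, r')`. -/
def extensionCount (t q r r' : ℕ) : ℕ :=
  Nat.card {x : (Fin (t + 1) → Bool) × (Fin (t + 1) → Fin (t + 2) × Fin (t + 2)) //
    IsPath x.1 ∧ upperCount x.1 = q ∧ IsLinearExtension x.1 x.2 ∧
      rankLeft x.1 x.2 = r ∧ rankRight x.1 x.2 = r'}

/-- `D_{m,n,p;q}`. -/
def D (m n p q : ℕ) : ℕ := extensionCount (m + n + p) q m p

/-- `E_{m,n,p;q}`. -/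
def E (m n p q : ℕ) : ℕ := extensionCount (m + n + p) q (m + n + 1) (n + p + 1)

/-! ### The limiting kernels -/

/-- `[m,n,p](x,y) = (x-a)^m/m! · (y-x)^n/n! · (b-y)^p/p!`. -/
def bracket (a b : ℝ) (m n p : ℕ) (x y : ℝ) : ℝ :=
  (x - a) ^ m / (m.factorial : ℝ) * ((y - x) ^ n / (n.factorial : ℝ))
    * ((b - y) ^ p / (p.factorial : ℝ))

/-- `f_s = ∑_{m+n+p=s-1} ∑_{q=0}^{s} D_{m,n,p;q} (-ν̄)^q ν^{s-q} [m,n,p]`, for `s ≥ 1`. -/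
def f (a b : ℝ) (ν : ℂ) (s : ℕ) (x y : ℝ) : ℂ :=
  ∑ m ∈ Finset.range s, ∑ n ∈ Finset.range s, ∑ p ∈ Finset.range s,
    if m + n + p + 1 = s then
      ∑ q ∈ Finset.range (s + 1), (D m n p q : ℂ) * (-(starRingEnd ℂ) ν) ^ q * ν ^ (s - q)
        * (bracket a b m n p x y : ℂ)
    else 0

/-- `g_s = ∑_{m+n+p=s-1} ∑_{q=0}^{s} E_{m,n,p;q} (-ν̄)^q ν^{s-q} [m,n,p]†`, for `s ≥ 1`, where
`[m,n,p]†(x,y) = [m,n,p](y,x)`. -/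
def g (a b : ℝ) (ν : ℂ) (s : ℕ) (x y : ℝ) : ℂ :=
  ∑ m ∈ Finset.range s, ∑ n ∈ Finset.range s, ∑ p ∈ Finset.range s,
    if m + n + p + 1 = s then
      ∑ q ∈ Finset.range (s + 1), (E m n p q : ℂ) * (-(starRingEnd ℂ) ν) ^ q * ν ^ (s - q)
        * (bracket a b m n p y x : ℂ)
    else 0

open Classical in
/-- The kernel `f_s(x,y) 1_{a ≤ x < y < b} + g_s(x,y) 1_{a ≤ y < x < b}`. -/
def kernel (a b : ℝ) (ν : ℂ) (s : ℕ) (x y : ℝ) : ℂ :=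
  (if a ≤ x ∧ x < y ∧ y < b then f a b ν s x y else 0)
    + (if a ≤ y ∧ y < x ∧ x < b then g a b ν s x y else 0)

/-- `T` is the integral operator on `L²([a,b))` with kernel `K`:
`(T h)(x) = ∫_a^b K(x,y) h(y) dy` for almost every `x`, the integral being convergent. -/
def IsIntegralOperator (a b : ℝ) (K : ℝ → ℝ → ℂ) (T : L2 a b →L[ℂ] L2 a b) : Prop :=
  ∀ h : L2 a b, ∀ᵐ x ∂(volume.restrict (Ico a b)),
    Integrable (fun y => K x y * h y) (volume.restrict (Ico a b)) ∧
      T h x = ∫ y in Ico a b, K x y * h y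

end CausalProduct

end

namespace CausalProduct

/-! The operators `E u v = |χ_u⟩⟨χ_v|` multiply as matrix units, because the normalized indicators
are orthonormal. Expanding `WN` therefore keeps only the products of factors whose labels chain into
a walk e₀, e₁, …, with weight -ν̄ for each ascent and ν for each descent. The factors stand in
lexicographic order of their index pairs, and for two edges {u,v}, {v,w} sharing the vertex v the
first pair precedes the second exactly when u < w. So `WN` is the identity plus the sum over all
walks with e_i < e_{i+2} (`list_prod_one_add`, `orderedDoubleProd_expansion`, `WN_eq`).

Such a walk interleaves two increasing sequences, its even and its odd vertices. This bounds the
term of order s + 1, as an integral kernel on the square, by `kernelBound`, which does not depend on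
N and is summable in s (`norm_walkMatrix_le`, `norm_discreteKernel_le`).

For fixed s, walks with distinct prescribed endpoints and a repeated vertex are fewer by a factor of
order N and disappear in the limit. A walk without repetition is a vertex set together with a
permutation σ of the ranks. Its weight depends only on σ, and the vertex sets giving the two
endpoints their ranks are counted by a product of three binomial coefficients, which rescales to
`bracket` (`injWalkMatrix_eq`, `positionCount_of_lt`, `tendsto_walkMatrix`). Permutations with σ(i)
< σ(i+2) are exactly the pairs (π, B): the path records the ascents, and the rank is read off from
the values at the two ends (`extensionCount_eq`). Hence the kernels converge pointwise off the
diagonal to `kernel`.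

Weak convergence follows from dominated convergence twice, on the square for each s and then for the
series in s; the uniform bound passes to the limit kernels and makes the operator series converge
absolutely. -/

/-! ### Expansion of a lexicographically ordered product into walks. -/

/-- The weight of an oriented edge: `-ν̄` for an ascent and `ν` for a descent. -/
noncomputable def stepWeight (ν : ℂ) (u v : ℕ) : ℂ :=
  if u < v then -(starRingEnd ℂ) ν else if v < u then ν else 0

/-- The strict lexicographic order on pairs of natural numbers. -/
def LexLT (p q : ℕ × ℕ) : Prop := p.1 < q.1 ∨ p.1 = q.1 ∧ p.2 < q.2

lemma sum_edge_cons {A : Type*} [AddCommGroup A] (V : Finset ℕ) (G : ℕ → ℕ → A)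
    (j k : ℕ) (hj : j ∈ V) (hk : k ∈ V) (hjk : j < k) (l : List (ℕ × ℕ)) (hl : (j, k) ∉ l) :
    (∑ u ∈ V, ∑ v ∈ V, if (min u v, max u v) ∈ (j, k) :: l then G u v else 0)
      = (∑ u ∈ V, ∑ v ∈ V, if (min u v, max u v) ∈ l then G u v else 0) + G j k + G k j := by
  have h : ∀ u v : ℕ, (if (min u v, max u v) ∈ (j, k) :: l then G u v else 0)
      = (if (min u v, max u v) ∈ l then G u v else 0)
        + (if u = j then (if v = k then G u v else 0) else 0)
        + (if u = k then (if v = j then G u v else 0) else 0) := by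
    intro u v
    by_cases h1 : u = j ∧ v = k
    · obtain ⟨rfl, rfl⟩ := h1
      simp [hjk.le, hl, hjk.ne]
    by_cases h2 : u = k ∧ v = j
    · obtain ⟨rfl, rfl⟩ := h2
      simp [hjk.le, hl, hjk.ne']
    have h3 : (min u v, max u v) ≠ (j, k) := by
      rw [Ne, Prod.mk.injEq]; omega
    have e1 : (if u = j then (if v = k then G u v else 0) else 0) = 0 := by
      split_ifs <;> simp_all
    have e2 : (if u = k then (if v = j then G u v else 0) else 0) = 0 := by
      split_ifs <;> simp_all
    rw [e1, e2]
    simp [h3]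
  simp only [h, Finset.sum_add_distrib]
  congr 1
  · congr 1
    rw [Finset.sum_eq_single j (by intro u _ hu; simp [hu]) (by simp [hj])]
    simp [hk]
  · rw [Finset.sum_eq_single k (by intro u _ hu; simp [hu]) (by simp [hk])]
    simp [hj]

/-- Here `F u v` collects all products that begin with `E u v`, and `h1` is its recursion on the
second factor. The induction multiplies on the left by the smallest remaining factor; `hup` makes
`l` a final segment of the lexicographic order, so membership of an edge in the tail is just the
comparison with the head. -/
theorem list_prod_one_add {A : Type*} [Ring A] [Algebra ℂ A] (V : Finset ℕ) (E F : ℕ → ℕ → A)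
    (κ : ℕ → ℕ → ℂ) (hκ : ∀ u, κ u u = 0)
    (h0 : ∀ u ∈ V, ∀ v ∈ V, ∀ v' ∈ V, ∀ w ∈ V, v ≠ v' → E u v * F v' w = 0)
    (h1 : ∀ u ∈ V, ∀ v ∈ V,
      F u v = E u v + ∑ w ∈ V, if u < w then κ v w • (E u v * F v w) else 0)
    (l : List (ℕ × ℕ)) (hV : ∀ p ∈ l, p.1 ∈ V ∧ p.2 ∈ V ∧ p.1 < p.2) (hl : l.Pairwise LexLT)
    (hup : ∀ p ∈ l, ∀ q : ℕ × ℕ, q.1 ∈ V → q.2 ∈ V → q.1 < q.2 → LexLT p q → q ∈ l) :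
    (l.map fun p => 1 + (κ p.1 p.2 • E p.1 p.2 + κ p.2 p.1 • E p.2 p.1)).prod
      = 1 + ∑ u ∈ V, ∑ v ∈ V, if (min u v, max u v) ∈ l then κ u v • F u v else 0 := by
  induction l with
  | nil => simp
  | cons p l ih =>
    obtain ⟨j, k⟩ := p
    obtain ⟨hj, hk, hjk⟩ := hV (j, k) (by simp)
    simp only at hj hk hjk
    rw [List.pairwise_cons] at hl
    have hnot : (j, k) ∉ l := fun h => by
      have := hl.1 _ h
      simp [LexLT] at this
    have ih' := ih (fun p hp => hV p (by simp [hp])) hl.2 (by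
      intro p hp q hq1 hq2 hq hpq
      have h := hup p (by simp [hp]) q hq1 hq2 hq hpq
      rcases List.mem_cons.1 h with h | h
      · exfalso
        have := hl.1 p hp
        subst h
        simp only [LexLT] at this hpq
        omega
      · exact h)
    have hmem : ∀ u v, u ∈ V → v ∈ V → u ≠ v →
        ((min u v, max u v) ∈ l ↔ LexLT (j, k) (min u v, max u v)) := by
      intro u v hu hv huv
      constructor
      · exact hl.1 _
      · intro h
        have hmin : min u v ∈ V := by rcases min_choice u v with h | h <;> rwa [h]
        have hmax : max u v ∈ V := by rcases max_choice u v with h | h <;> rwa [h]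
        have := hup (j, k) (by simp) (min u v, max u v) hmin hmax (by simp; omega) h
        rcases List.mem_cons.1 this with h' | h'
        · rw [h'] at h
          simp [LexLT] at h
        · exact h'
    -- In `E u v` times the tail only the terms starting at `v` survive, and membership in the tail
    -- becomes the condition `u < w`, so the recursion `h1` reassembles `F u v`.
    have key : ∀ u v, u ∈ V → v ∈ V →
        (∀ w ∈ V, v ≠ w → (LexLT (j, k) (min v w, max v w) ↔ u < w)) →
        E u v * (1 + ∑ u ∈ V, ∑ v ∈ V, if (min u v, max u v) ∈ l then κ u v • F u v else 0)
          = F u v := by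
      intro u v hu hv hw
      rw [h1 u hu v hv, mul_add, mul_one, Finset.mul_sum]
      congr 1
      rw [Finset.sum_eq_single v]
      · rw [Finset.mul_sum]
        refine Finset.sum_congr rfl fun w hwV => ?_
        by_cases hvw : v = w
        · subst hvw; simp [hκ]
        · rw [mul_ite, mul_zero, mul_smul_comm]
          simp only [hmem v w hv hwV hvw, hw w hwV hvw]
      · intro v' hv' hne
        rw [Finset.mul_sum]
        refine Finset.sum_eq_zero fun w hwV => ?_
        rw [mul_ite, mul_zero, mul_smul_comm, h0 u hu v hv v' hv' w hwV hne.symm]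
        simp
      · exact fun h => absurd hv h
    -- Both orientations of the head edge: for `j < k`, the pair of {k,w} follows (j,k) iff j < w,
    -- and the pair of {j,w} follows (j,k) iff k < w.
    have k1 := key j k hj hk (by intro w _ hw; simp only [LexLT]; omega)
    have k2 := key k j hk hj (by intro w _ hw; simp only [LexLT]; omega)
    rw [sum_edge_cons V (fun u v => κ u v • F u v) j k hj hk hjk l hnot, List.map_cons,
      List.prod_cons, ih', add_mul, one_mul, add_mul, smul_mul_assoc, smul_mul_assoc, k1, k2]
    abel

/-- The list of pairs `(j, k)`, `1 ≤ j < k ≤ N`, in lexicographic order. -/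
def pairList (N : ℕ) : List (ℕ × ℕ) :=
  (List.Ico 1 N).flatMap fun j => (List.Ico (j + 1) (N + 1)).map fun k => (j, k)

lemma mem_pairList {N : ℕ} {p : ℕ × ℕ} :
    p ∈ pairList N ↔ 1 ≤ p.1 ∧ p.1 < p.2 ∧ p.2 ≤ N := by
  obtain ⟨j, k⟩ := p
  simp only [pairList, List.mem_flatMap, List.Ico.mem, List.mem_map, Prod.mk.injEq]
  constructor
  · rintro ⟨j', hj, k', hk, rfl, rfl⟩; omega
  · intro h; exact ⟨j, by omega, k, by omega, rfl, rfl⟩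

lemma pairwise_pairList (N : ℕ) : (pairList N).Pairwise LexLT := by
  rw [pairList, List.pairwise_flatMap]
  constructor
  · intro j _
    rw [List.pairwise_map]
    exact (List.Ico.pairwise_lt _ _).imp fun h => Or.inr ⟨rfl, h⟩
  · refine (List.Ico.pairwise_lt _ _).imp fun {a b} h => ?_
    simp only [List.mem_map]
    rintro _ ⟨k, _, rfl⟩ _ ⟨k', _, rfl⟩
    exact Or.inl h

lemma orderedDoubleProd_eq {A : Type*} [Monoid A] (N : ℕ) (x : ℕ → ℕ → A) :
    orderedDoubleProd N x = ((pairList N).map fun p => x p.1 p.2).prod := by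
  rw [orderedDoubleProd, pairList, List.map_flatMap, List.flatMap_def, List.prod_flatten,
    List.map_map]
  simp [Function.comp_def]

/-- The total weight of the walks `u, v = e₀, …, e_s = y` in `V` with `u < e₁` and
`e_i < e_{i+2}`; the step `u → v` is not weighted. -/
noncomputable def walkSum (ν : ℂ) (V : Finset ℕ) : ℕ → ℕ → ℕ → ℕ → ℂ
  | 0, _, v, y => if v = y then 1 else 0
  | s + 1, u, v, y =>
    ∑ w ∈ V, if u < w then stepWeight ν v w * walkSum ν V s v w y else 0

/-- The total weight of the walks of `s + 1` steps from `x` to `y` in `V` with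
`e_i < e_{i+2}`. -/
noncomputable def walkMatrix (ν : ℂ) (V : Finset ℕ) (s x y : ℕ) : ℂ :=
  ∑ v ∈ V, stepWeight ν x v * walkSum ν V s x v y

/-- Specializes the recursion to matrix units, where `F u v` is a combination of the `E u y` with
coefficients `walkSum`. The vanishing at length `S` turns the formal series into a finite sum. -/
theorem orderedDoubleProd_expansion {A : Type*} [Ring A] [Algebra ℂ A] (ν : ℂ) (h : ℂ) (N S : ℕ)
    (E : ℕ → ℕ → A)
    (hE : ∀ u ∈ Finset.Icc 1 N, ∀ v ∈ Finset.Icc 1 N, ∀ v' ∈ Finset.Icc 1 N,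
      ∀ w ∈ Finset.Icc 1 N, E u v * E v' w = if v = v' then E u w else 0)
    (hS : ∀ u v y, walkSum ν (Finset.Icc 1 N) S u v y = 0) :
    orderedDoubleProd N
        (fun j k => 1 + h • ((-(starRingEnd ℂ) ν) • E j k + ν • E k j))
      = 1 + ∑ s ∈ Finset.range S, h ^ (s + 1) • ∑ x ∈ Finset.Icc 1 N, ∑ y ∈ Finset.Icc 1 N,
          walkMatrix ν (Finset.Icc 1 N) s x y • E x y := by
  set V := Finset.Icc 1 N with hV
  set F : ℕ → ℕ → A := fun u v =>
    ∑ s ∈ Finset.range S, ∑ y ∈ V, (h ^ s * walkSum ν V s u v y) • E u y with hF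
  have hEF : ∀ u ∈ V, ∀ v ∈ V, ∀ v' ∈ V, ∀ w ∈ V, E u v * F v' w = if v = v' then
      ∑ s ∈ Finset.range S, ∑ y ∈ V, (h ^ s * walkSum ν V s v' w y) • E u y else 0 := by
    intro u hu v hv v' hv' w _
    have : ∀ s, ∀ y ∈ V, E u v * ((h ^ s * walkSum ν V s v' w y) • E v' y)
        = if v = v' then (h ^ s * walkSum ν V s v' w y) • E u y else 0 := by
      intro s y hy
      rw [mul_smul_comm, hE u hu v hv v' hv' y hy, smul_ite, smul_zero]
    simp only [hF, Finset.mul_sum]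
    rw [Finset.sum_congr rfl fun s _ => Finset.sum_congr rfl (this s)]
    split_ifs <;> simp
  have main := list_prod_one_add V E F (fun u v => h * stepWeight ν u v)
    (by simp [stepWeight])
    (by intro u hu v hv v' hv' w hw hne; rw [hEF u hu v hv v' hv' w hw, if_neg hne])
    (by
      intro u hu v hv
      -- One step of the recursion lengthens each walk by one; the extra term of order `S` may be
      -- added because it is zero.
      have e1 : F u v = ∑ s ∈ Finset.range (S + 1), ∑ y ∈ V,
          (h ^ s * walkSum ν V s u v y) • E u y := by
        rw [Finset.sum_range_succ]
        simp [hF, hS]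
      rw [e1, Finset.sum_range_succ', add_comm]
      congr 1
      · simp [walkSum, ite_smul, hv]
      · have e2 : ∀ w ∈ V, (if u < w then (h * stepWeight ν v w) • (E u v * F v w) else 0)
            = ∑ s ∈ Finset.range S, ∑ y ∈ V, (if u < w then
              (h ^ (s + 1) * (stepWeight ν v w * walkSum ν V s v w y)) • E u y else 0) := by
          intro w hw
          rw [hEF u hu v hv v hv w hw, if_pos rfl]
          split_ifs
          · simp only [Finset.smul_sum, smul_smul]
            refine Finset.sum_congr rfl fun s _ => Finset.sum_congr rfl fun y _ => ?_
            congr 1; ring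
          · simp
        rw [Finset.sum_congr rfl e2, Finset.sum_comm (s := V)]
        refine Finset.sum_congr rfl fun s _ => ?_
        conv_rhs => rw [Finset.sum_comm]
        refine Finset.sum_congr rfl fun y _ => ?_
        rw [walkSum, Finset.mul_sum, Finset.sum_smul]
        refine Finset.sum_congr rfl fun w _ => ?_
        split_ifs <;> simp)
    (pairList N)
    (by
      intro p hp
      rw [mem_pairList] at hp
      simp only [hV, Finset.mem_Icc]; omega)
    (pairwise_pairList N)
    (by
      intro p _ q h1 h2 h3 _
      rw [mem_pairList]
      simp only [hV, Finset.mem_Icc] at h1 h2; omega)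
  rw [orderedDoubleProd_eq]
  have e3 : ∀ p ∈ pairList N,
      1 + h • ((-(starRingEnd ℂ) ν) • E p.1 p.2 + ν • E p.2 p.1)
        = 1 + ((h * stepWeight ν p.1 p.2) • E p.1 p.2
          + (h * stepWeight ν p.2 p.1) • E p.2 p.1) := by
    intro p hp
    rw [mem_pairList] at hp
    simp [stepWeight, hp.2.1, not_lt.2 hp.2.1.le, smul_smul]
  rw [List.map_congr_left e3, main]
  congr 1
  have e4 : ∀ u ∈ V, ∀ v ∈ V, (if (min u v, max u v) ∈ pairList N then
      (h * stepWeight ν u v) • F u v else 0) = ∑ s ∈ Finset.range S, ∑ y ∈ V,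
        (h ^ (s + 1) * (stepWeight ν u v * walkSum ν V s u v y)) • E u y := by
    intro u hu v hv
    have e5 : ∑ s ∈ Finset.range S, ∑ y ∈ V,
        (h ^ (s + 1) * (stepWeight ν u v * walkSum ν V s u v y)) • E u y
        = (h * stepWeight ν u v) • F u v := by
      simp only [hF, Finset.smul_sum, smul_smul]
      refine Finset.sum_congr rfl fun s _ => Finset.sum_congr rfl fun y _ => ?_
      congr 1; ring
    rw [e5]
    by_cases huv : u = v
    · subst huv; simp [stepWeight]
    · rw [if_pos]
      rw [mem_pairList]
      simp only [hV, Finset.mem_Icc] at hu hv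
      simp only
      omega
  rw [Finset.sum_congr rfl fun u hu => Finset.sum_congr rfl (e4 u hu)]
  rw [Finset.sum_congr rfl fun u _ => Finset.sum_comm, Finset.sum_comm]
  refine Finset.sum_congr rfl fun s _ => ?_
  rw [Finset.smul_sum]
  refine Finset.sum_congr rfl fun u _ => ?_
  rw [Finset.sum_comm, Finset.smul_sum]
  refine Finset.sum_congr rfl fun y _ => ?_
  rw [smul_smul, walkMatrix, Finset.mul_sum, Finset.sum_smul]

/-! ### Bounds on the walk sums. -/

lemma norm_stepWeight_le (ν : ℂ) (u v : ℕ) : ‖stepWeight ν u v‖ ≤ ‖ν‖ := by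
  unfold stepWeight
  split_ifs <;> simp

lemma sum_choose_sub (N u k : ℕ) :
    (∑ w ∈ Finset.Icc 1 N, if u < w then (N - w).choose k else 0) = (N - u).choose (k + 1) := by
  have h : ∀ d : ℕ, ∑ i ∈ Finset.range d, i.choose k = d.choose (k + 1) := by
    intro d
    induction d with
    | zero => simp
    | succ d ih => rw [Finset.sum_range_succ, ih, Nat.choose_succ_succ, add_comm]
  rw [← h, ← Finset.sum_filter]
  refine Finset.sum_nbij' (fun w => N - w) (fun i => N - i) ?_ ?_ ?_ ?_ ?_ <;>
    simp only [Finset.mem_filter, Finset.mem_Icc, Finset.mem_range] <;> intros <;>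
    first | omega | trivial

/-- The endpoint `y` pins the last vertex, leaving `s` free ones. They split alternately into an
increasing sequence above `u` and one above `v`, of lengths ⌈s/2⌉ and ⌊s/2⌋. In the induction these
roles swap, and the sum over the next vertex is the hockey-stick identity. -/
lemma norm_walkSum_le (ν : ℂ) (N s u v y : ℕ) :
    ‖walkSum ν (Finset.Icc 1 N) (s + 1) u v y‖
      ≤ ‖ν‖ ^ (s + 1) * ((N - u).choose ((s + 1) / 2) * (N - v).choose (s / 2) : ℕ) := by
  induction s generalizing u v with
  | zero =>
    simp only [walkSum, mul_ite, mul_one, mul_zero]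
    have : (∑ w ∈ Finset.Icc 1 N, if u < w then (if w = y then stepWeight ν v w else 0) else 0)
        = if y ∈ Finset.Icc 1 N then (if u < y then stepWeight ν v y else 0) else 0 := by
      split_ifs with h1 h2
      · rw [Finset.sum_eq_single y (by intro w _ hw; simp [hw]) (fun h => absurd h1 h)]; simp [h2]
      · rw [Finset.sum_eq_single y (by intro w _ hw; simp [hw]) (fun h => absurd h1 h)]; simp [h2]
      · refine Finset.sum_eq_zero fun w hw => ?_
        have : w ≠ y := by rintro rfl; exact h1 hw
        simp [this]
    rw [this]
    split_ifs <;> simp [norm_stepWeight_le]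
  | succ s ih =>
    rw [walkSum]
    calc _ ≤ ∑ w ∈ Finset.Icc 1 N, ‖ν‖ ^ (s + 2) * (N - v).choose ((s + 1) / 2)
            * ((if u < w then (N - w).choose (s / 2) else 0 : ℕ) : ℝ) := by
          refine norm_sum_le_of_le _ fun w _ => ?_
          split_ifs
          · rw [norm_mul]
            calc _ ≤ ‖ν‖ * _ := mul_le_mul (norm_stepWeight_le ν v w) (ih v w)
                  (norm_nonneg _) (norm_nonneg _)
              _ = _ := by push_cast; ring
          · simp
      _ = _ := by
          rw [← Finset.mul_sum, ← Nat.cast_sum, sum_choose_sub,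
            show (s + 1 + 1) / 2 = s / 2 + 1 by omega]
          push_cast; ring

/-- A walk this long would need N + 1 increasing free vertices in {u+1, …, N}. -/
lemma walkSum_eq_zero (ν : ℂ) (N u v y : ℕ) :
    walkSum ν (Finset.Icc 1 N) (2 * N + 2) u v y = 0 := by
  have h := norm_walkSum_le ν N (2 * N + 1) u v y
  rw [Nat.choose_eq_zero_of_lt (show N - u < (2 * N + 1 + 1) / 2 by omega)] at h
  simpa using h

lemma inv_factorial_mul_le (s : ℕ) :
    (1 : ℝ) / ((((s + 1) / 2).factorial : ℝ) * ((s / 2).factorial : ℝ))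
      ≤ 2 ^ s / (s.factorial : ℝ) := by
  have h := Nat.choose_mul_factorial_mul_factorial (show s / 2 ≤ s by omega)
  rw [show s - s / 2 = (s + 1) / 2 by omega] at h
  rw [div_le_div_iff₀ (by positivity) (by positivity), one_mul]
  have h2 := Nat.choose_le_two_pow s (s / 2)
  have : s.factorial ≤ 2 ^ s * (((s + 1) / 2).factorial * (s / 2).factorial) := by
    rw [← h]
    calc _ = s.choose (s / 2) * (((s + 1) / 2).factorial * (s / 2).factorial) := by ring
      _ ≤ _ := Nat.mul_le_mul_right _ h2
  exact_mod_cast this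

/-- The binomials give N^s / (⌈s/2⌉! ⌊s/2⌋!) ≤ N^s 2^s / s! with s = t - 1, and the free choice of
the second vertex costs one more N. For t = 0 the truncated subtraction gives 0! = 1. -/
lemma norm_walkMatrix_le (ν : ℂ) (N t x y : ℕ) :
    ‖walkMatrix ν (Finset.Icc 1 N) t x y‖
      ≤ ‖ν‖ ^ (t + 1) * ((N : ℝ) ^ t * 2 ^ t / ((t - 1).factorial : ℝ)) := by
  cases t with
  | zero =>
    by_cases hy : y ∈ Finset.Icc 1 N
    · simp [walkMatrix, walkSum, -Finset.mem_Icc, hy, norm_stepWeight_le]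
    · simp [walkMatrix, walkSum, -Finset.mem_Icc, hy]
  | succ s =>
    rw [walkMatrix]
    calc _ ≤ ∑ v ∈ Finset.Icc 1 N, ‖ν‖ ^ (s + 2) * ((N : ℝ) ^ s * 2 ^ s / (s.factorial : ℝ)) := by
          refine norm_sum_le_of_le _ fun v _ => ?_
          rw [norm_mul]
          calc _ ≤ ‖ν‖ * _ := mul_le_mul (norm_stepWeight_le ν x v) (norm_walkSum_le ν N s x v y)
                (norm_nonneg _) (norm_nonneg _)
            _ ≤ ‖ν‖ * (‖ν‖ ^ (s + 1) * ((N : ℝ) ^ ((s + 1) / 2) / ((s + 1) / 2).factorial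
                  * ((N : ℝ) ^ (s / 2) / (s / 2).factorial))) := by
                have hc : ∀ a k : ℕ, ((N - a).choose k : ℝ) ≤ (N : ℝ) ^ k / k.factorial := by
                  intro a k
                  refine (Nat.cast_le.2 (Nat.choose_le_choose k (Nat.sub_le N a))).trans ?_
                  exact Nat.choose_le_pow_div k N
                push_cast
                gcongr <;> apply hc
            _ = ‖ν‖ ^ (s + 2) * ((N : ℝ) ^ s
                  * (1 / ((((s + 1) / 2).factorial : ℝ) * ((s / 2).factorial : ℝ)))) := by
                have : (N : ℝ) ^ s = (N : ℝ) ^ ((s + 1) / 2) * (N : ℝ) ^ (s / 2) := by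
                  rw [← pow_add]; congr 1; omega
                rw [this]; field_simp; ring
            _ ≤ ‖ν‖ ^ (s + 2) * ((N : ℝ) ^ s * (2 ^ s / (s.factorial : ℝ))) := by
                gcongr ?_ * (?_ * ?_); exact inv_factorial_mul_le s
            _ = _ := by ring
      _ = ‖ν‖ ^ (s + 2) * ((N : ℝ) ^ (s + 1) * 2 ^ s / (s.factorial : ℝ)) := by
          rw [Finset.sum_const, Nat.card_Icc]; simp; ring
      _ ≤ _ := by
          rw [Nat.add_sub_cancel]
          have : (2 : ℝ) ^ s ≤ 2 ^ (s + 1) := pow_le_pow_right₀ (by norm_num) (by omega)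
          gcongr

/-! ### Walks as functions -/

open Classical in
/-- The weight of the walk `e₀, …, e_{t+1}`: the product of its step weights if
`e_i < e_{i+2}` for all `i`, and `0` otherwise. -/
noncomputable def pathWeight (ν : ℂ) {t : ℕ} (e : Fin (t + 2) → ℕ) : ℂ :=
  (∏ i : Fin (t + 1), stepWeight ν (e i.castSucc) (e i.succ)) *
    if ∀ i : Fin t, e i.castSucc.castSucc < e i.succ.succ then 1 else 0

lemma sum_piFinset_cons {A : Type*} [AddCommMonoid A] (V : Finset ℕ) (n : ℕ)
    (G : (Fin (n + 1) → ℕ) → A) :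
    ∑ e ∈ Fintype.piFinset (fun _ : Fin (n + 1) => V), G e
      = ∑ u ∈ V, ∑ e ∈ Fintype.piFinset (fun _ : Fin n => V), G (Fin.cons u e) := by
  rw [← Finset.sum_product']
  refine (Finset.sum_nbij' (fun x => Fin.cons x.1 x.2) (fun e => (e 0, Fin.tail e))
    ?_ ?_ ?_ ?_ ?_).symm
  · rintro ⟨u, e⟩ h
    simp only [Finset.mem_product, Fintype.mem_piFinset] at h ⊢
    exact Fin.cases h.1 h.2
  · intro e h
    simp only [Finset.mem_product, Fintype.mem_piFinset] at h ⊢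
    exact ⟨h 0, fun i => h i.succ⟩
  · rintro ⟨u, e⟩ _; simp
  · intro e _; simp
  · rintro ⟨u, e⟩ _; rfl

lemma pathWeight_cons (ν : ℂ) {t : ℕ} (u : ℕ) (e : Fin (t + 2) → ℕ) :
    pathWeight ν (Fin.cons u e : Fin (t + 3) → ℕ)
      = stepWeight ν u (e 0) * (if u < e 1 then 1 else 0) * pathWeight ν e := by
  have h : (∀ i : Fin (t + 1), (Fin.cons u e : Fin (t + 3) → ℕ) i.castSucc.castSucc
      < (Fin.cons u e : Fin (t + 3) → ℕ) i.succ.succ)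
      ↔ u < e 1 ∧ ∀ i : Fin t, e i.castSucc.castSucc < e i.succ.succ := by
    rw [Fin.forall_fin_succ]
    simp only [Fin.castSucc_zero, Fin.cons_zero, Fin.cons_succ, ← Fin.succ_castSucc]
    rfl
  rw [pathWeight, pathWeight, if_congr h rfl rfl, Fin.prod_univ_succ (n := t + 1)]
  simp only [Fin.castSucc_zero, Fin.cons_zero, Fin.cons_succ, ← Fin.succ_castSucc]
  by_cases h1 : u < e 1 <;> simp [h1]

lemma stepWeight_mul_walkSum (ν : ℂ) (V : Finset ℕ) (t u v y : ℕ) (hu : u ∈ V) (hv : v ∈ V) :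
    stepWeight ν u v * walkSum ν V t u v y
      = ∑ e ∈ Fintype.piFinset (fun _ : Fin (t + 2) => V),
          if e 0 = u ∧ e 1 = v ∧ e (Fin.last _) = y then pathWeight ν e else 0 := by
  induction t generalizing u v with
  | zero =>
    rw [sum_piFinset_cons, Finset.sum_eq_single u (by intro b _ hb; simp [hb])
      (fun h => absurd hu h), sum_piFinset_cons, Finset.sum_eq_single v
      (by intro b _ hb; simp [hb]) (fun h => absurd hv h)]
    have : ∀ e : Fin 0 → ℕ, pathWeight ν (Fin.cons u (Fin.cons v e : Fin 1 → ℕ) : Fin 2 → ℕ)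
        = stepWeight ν u v := by
      intro e; simp [pathWeight]
    simp only [this]
    simp [walkSum, show (Fin.last 1) = Fin.succ 0 from rfl]
  | succ t ih =>
    rw [walkSum, Finset.mul_sum]
    have e1 : ∀ w ∈ V, stepWeight ν u v * (if u < w then
        stepWeight ν v w * walkSum ν V t v w y else 0)
        = ∑ e ∈ Fintype.piFinset (fun _ : Fin (t + 2) => V), if e 1 = w then
          (if e 0 = v ∧ e (Fin.last _) = y then
            stepWeight ν u (e 0) * (if u < e 1 then 1 else 0) * pathWeight ν e else 0) else 0 := by
      intro w hw
      split_ifs with huw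
      · rw [ih v w hv hw, Finset.mul_sum]
        refine Finset.sum_congr rfl fun e _ => ?_
        by_cases h0 : e 0 = v
        · by_cases h1 : e 1 = w
          · simp [h0, h1, huw]
          · simp [h1]
        · simp [h0]
      · rw [mul_zero]
        refine (Finset.sum_eq_zero fun e _ => ?_).symm
        by_cases h1 : e 1 = w
        · simp [h1, huw]
        · simp [h1]
    rw [Finset.sum_congr rfl e1, Finset.sum_comm, sum_piFinset_cons V (t + 2),
      Finset.sum_eq_single u (by intro b _ hb; simp [hb]) (fun h => absurd hu h)]
    refine Finset.sum_congr rfl fun e he => ?_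
    rw [Finset.sum_ite_eq, if_pos (Fintype.mem_piFinset.1 he 1)]
    have h1 : (Fin.cons u e : Fin (t + 3) → ℕ) 1 = e 0 := rfl
    have h2 : (Fin.cons u e : Fin (t + 3) → ℕ) (Fin.last (t + 2)) = e (Fin.last (t + 1)) := rfl
    rw [pathWeight_cons, h1, h2, Fin.cons_zero]
    simp

theorem walkMatrix_eq_sum (ν : ℂ) (V : Finset ℕ) (t x y : ℕ) (hx : x ∈ V) :
    walkMatrix ν V t x y
      = ∑ e ∈ Fintype.piFinset (fun _ : Fin (t + 2) => V),
          if e 0 = x ∧ e (Fin.last _) = y then pathWeight ν e else 0 := by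
  rw [walkMatrix, Finset.sum_congr rfl fun v hv => stepWeight_mul_walkSum ν V t x v y hx hv,
    Finset.sum_comm]
  refine Finset.sum_congr rfl fun e he => ?_
  rw [Finset.sum_eq_single (e 1)]
  · simp
  · intro v _ hv; simp [hv.symm]
  · exact fun h => absurd (Fintype.mem_piFinset.1 he 1) h

lemma norm_pathWeight_le (ν : ℂ) {t : ℕ} (e : Fin (t + 2) → ℕ) :
    ‖pathWeight ν e‖ ≤ ‖ν‖ ^ (t + 1) := by
  rw [pathWeight, norm_mul, norm_prod]
  calc _ ≤ (∏ _i : Fin (t + 1), ‖ν‖) * 1 := by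
        refine mul_le_mul ?_ ?_ (norm_nonneg _) (Finset.prod_nonneg fun _ _ => norm_nonneg _)
        · exact Finset.prod_le_prod (fun _ _ => norm_nonneg _) fun _ _ => norm_stepWeight_le ..
        · split_ifs <;> simp
    _ = _ := by simp

/-- Only the relative order of the vertices matters, so a walk may be replaced by the sequence of
its ranks. -/
lemma pathWeight_congr (ν : ℂ) {t : ℕ} {e e' : Fin (t + 2) → ℕ}
    (h : ∀ i j, e i < e j ↔ e' i < e' j) : pathWeight ν e = pathWeight ν e' := by
  simp only [pathWeight, stepWeight, h]

/-! ### Walks with a repeated vertex -/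

/-- A repetition at an interior index makes that vertex redundant. Overwriting it by an arbitrary
element of `V` maps the pairs (walk, element) injectively to free choices of the `t` interior
vertices. -/
lemma card_filter_eq_mul_le (V : Finset ℕ) (t : ℕ) (x y : ℕ) (i : Fin t) (a : Fin (t + 2))
    (ha : a ≠ i.succ.castSucc) :
    ((Fintype.piFinset fun _ : Fin (t + 2) => V).filter fun e =>
      e 0 = x ∧ e (Fin.last _) = y ∧ e a = e i.succ.castSucc).card * V.card ≤ V.card ^ t := by
  have hcard : (Fintype.piFinset fun _ : Fin t => V).card = V.card ^ t := by simp
  rw [← Finset.card_product, ← hcard]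
  refine Finset.card_le_card_of_injOn
    (fun z i' => if i' = i then z.2 else z.1 i'.succ.castSucc) ?_ ?_
  · rintro ⟨e, w⟩ h
    simp only [Finset.coe_product, Set.mem_prod, Finset.mem_coe, Finset.mem_filter,
      Fintype.mem_piFinset] at h ⊢
    intro i'
    split_ifs
    · exact h.2
    · exact h.1.1 _
  · rintro ⟨e, w⟩ h ⟨e', w'⟩ h' heq
    simp only [Finset.coe_product, Set.mem_prod, Finset.mem_coe, Finset.mem_filter,
      Fintype.mem_piFinset] at h h' heq
    have hw : w = w' := by simpa using congrFun heq i
    have hne : ∀ m, m ≠ i.succ.castSucc → e m = e' m := by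
      intro m hm
      induction m using Fin.lastCases with
      | last => rw [h.1.2.2.1, h'.1.2.2.1]
      | cast m =>
        induction m using Fin.cases with
        | zero => exact h.1.2.1.trans h'.1.2.1.symm
        | succ m =>
          have hmi : m ≠ i := by rintro rfl; exact hm rfl
          simpa [hmi] using congrFun heq m
    have : e = e' := by
      funext m
      by_cases hm : m = i.succ.castSucc
      · rw [hm, ← h.1.2.2.2, ← h'.1.2.2.2, hne a ha]
      · exact hne m hm
    rw [hw, this]

lemma exists_interior_eq {t : ℕ} {e : Fin (t + 2) → ℕ} (h0 : e 0 ≠ e (Fin.last _))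
    (he : ¬ Function.Injective e) :
    ∃ (i : Fin t) (a : Fin (t + 2)), a ≠ i.succ.castSucc ∧ e a = e i.succ.castSucc := by
  simp only [Function.Injective, not_forall] at he
  obtain ⟨p, q, hpq, hne⟩ := he
  have key : ∀ m : Fin (t + 2), m = 0 ∨ m = Fin.last _ ∨ ∃ i : Fin t, m = i.succ.castSucc := by
    intro m
    induction m using Fin.lastCases with
    | last => simp
    | cast m =>
      induction m using Fin.cases with
      | zero => simp
      | succ m => exact Or.inr (Or.inr ⟨m, rfl⟩)
  rcases key p with rfl | rfl | ⟨i, rfl⟩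
  · rcases key q with rfl | rfl | ⟨i, rfl⟩
    · exact absurd rfl hne
    · exact absurd hpq h0
    · exact ⟨i, _, hne, hpq⟩
  · rcases key q with rfl | rfl | ⟨i, rfl⟩
    · exact absurd hpq.symm h0
    · exact absurd rfl hne
    · exact ⟨i, _, hne, hpq⟩
  · exact ⟨i, q, Ne.symm hne, hpq.symm⟩

open Classical in
lemma card_not_injective_mul_le (V : Finset ℕ) (t : ℕ) (x y : ℕ) (hxy : x ≠ y) :
    ((Fintype.piFinset fun _ : Fin (t + 2) => V).filter fun e =>
      (e 0 = x ∧ e (Fin.last _) = y) ∧ ¬ Function.Injective e).card * V.card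
        ≤ (t * (t + 2)) * V.card ^ t := by
  set P : Finset (Fin t × Fin (t + 2)) :=
    Finset.univ.filter fun z => z.2 ≠ z.1.succ.castSucc
  have hsub : ((Fintype.piFinset fun _ : Fin (t + 2) => V).filter fun e =>
      (e 0 = x ∧ e (Fin.last _) = y) ∧ ¬ Function.Injective e) ⊆ P.biUnion fun z =>
        (Fintype.piFinset fun _ : Fin (t + 2) => V).filter fun e =>
          e 0 = x ∧ e (Fin.last _) = y ∧ e z.2 = e z.1.succ.castSucc := by
    intro e he
    simp only [Finset.mem_filter, Finset.mem_biUnion, P, Finset.mem_univ, true_and] at he ⊢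
    obtain ⟨h1, ⟨h2, h3⟩, h4⟩ := he
    obtain ⟨i, a, h5, h6⟩ := exists_interior_eq (by rwa [h2, h3]) h4
    exact ⟨(i, a), h5, h1, h2, h3, h6⟩
  calc _ ≤ (∑ z ∈ P, ((Fintype.piFinset fun _ : Fin (t + 2) => V).filter fun e =>
          e 0 = x ∧ e (Fin.last _) = y ∧ e z.2 = e z.1.succ.castSucc).card) * V.card :=
        Nat.mul_le_mul_right _ ((Finset.card_le_card hsub).trans Finset.card_biUnion_le)
    _ ≤ ∑ z ∈ P, V.card ^ t := by
        rw [Finset.sum_mul]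
        refine Finset.sum_le_sum fun z hz => card_filter_eq_mul_le V t x y z.1 z.2 ?_
        simpa [P] using hz
    _ ≤ _ := by
        rw [Finset.sum_const, smul_eq_mul]
        refine Nat.mul_le_mul_right _ ((Finset.card_le_univ P).trans ?_)
        simp

open Classical in
/-- The part of `walkMatrix` that comes from the walks without repeated vertices. -/
noncomputable def injWalkMatrix (ν : ℂ) (V : Finset ℕ) (t x y : ℕ) : ℂ :=
  ∑ e ∈ (Fintype.piFinset fun _ : Fin (t + 2) => V).filter Function.Injective,
    if e 0 = x ∧ e (Fin.last _) = y then pathWeight ν e else 0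

/-- The difference is a sum over walks with a repetition. Since the endpoints differ, an interior
vertex takes part in it, which saves one power of the cardinality of `V` compared with all walks. -/
lemma norm_walkMatrix_sub_inj_le (ν : ℂ) (V : Finset ℕ) (t x y : ℕ) (hx : x ∈ V) (hxy : x ≠ y) :
    ‖walkMatrix ν V t x y - injWalkMatrix ν V t x y‖ * V.card
      ≤ ‖ν‖ ^ (t + 1) * (t * (t + 2) : ℕ) * (V.card : ℝ) ^ t := by
  classical
  rw [walkMatrix_eq_sum ν V t x y hx, injWalkMatrix,
    ← Finset.sum_filter_add_sum_filter_not _ (Function.Injective), add_sub_cancel_left,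
    ← Finset.sum_filter, Finset.filter_filter]
  have h := card_not_injective_mul_le V t x y hxy
  have h' : ((((Fintype.piFinset fun _ : Fin (t + 2) => V).filter fun e =>
      (e 0 = x ∧ e (Fin.last _) = y) ∧ ¬ Function.Injective e).card : ℝ)) * V.card
        ≤ (t * (t + 2) : ℕ) * (V.card : ℝ) ^ t := by exact_mod_cast h
  have h2 := norm_sum_le_of_le ((Fintype.piFinset fun _ : Fin (t + 2) => V).filter fun e =>
    ¬ Function.Injective e ∧ (e 0 = x ∧ e (Fin.last _) = y))
    fun e _ => norm_pathWeight_le ν e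
  rw [Finset.sum_const, nsmul_eq_mul] at h2
  simp only [and_comm (a := ¬ Function.Injective _)] at h2 ⊢
  calc _ ≤ _ := mul_le_mul_of_nonneg_right h2 (Nat.cast_nonneg _)
    _ = ‖ν‖ ^ (t + 1) * (((Fintype.piFinset fun _ : Fin (t + 2) => V).filter fun e =>
      (e 0 = x ∧ e (Fin.last _) = y) ∧ ¬ Function.Injective e).card * V.card) := by ring
    _ ≤ _ := by rw [mul_assoc]; gcongr

/-! ### Walks without repeated vertices -/

lemma count_mem_eq (S : Finset ℕ) (n : ℕ) :
    Nat.count (· ∈ S) n = (S.filter (· < n)).card := by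
  rw [Nat.count_eq_card_filter_range]
  congr 1
  ext v
  simp [and_comm]

lemma finite_mem (S : Finset ℕ) : (Set.ofPred (· ∈ S)).Finite := S.finite_toSet

lemma card_finite_mem (S : Finset ℕ) : (finite_mem S).toFinset.card = S.card := by
  congr 1
  ext v
  rw [Set.Finite.mem_toFinset]
  rfl

-- An injective sequence amounts to its image together with the permutation of ranks; `Nat.nth`
-- enumerates the image increasingly and `Nat.count` recovers the rank.
open Classical in
lemma sum_injective (V : Finset ℕ) (n : ℕ) (G : (Fin n → ℕ) → ℂ) :
    ∑ e ∈ (Fintype.piFinset fun _ : Fin n => V).filter Function.Injective, G e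
      = ∑ S ∈ V.powersetCard n, ∑ σ : Equiv.Perm (Fin n),
          G fun i => Nat.nth (· ∈ S) (σ i) := by
  rw [← Finset.sum_product']
  have lt_card : ∀ {S : Finset ℕ}, S.card = n → ∀ i : Fin n,
      (i : ℕ) < (finite_mem S).toFinset.card := by
    intro S hS i; rw [card_finite_mem, hS]; exact i.2
  have hinj : ∀ {S : Finset ℕ}, S.card = n → Function.Injective fun i : Fin n =>
      Nat.nth (· ∈ S) (i : ℕ) := by
    intro S hS i j hij
    exact Fin.ext (Nat.nth_injOn (finite_mem S) (lt_card hS i) (lt_card hS j) hij)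
  have himg : ∀ {S : Finset ℕ}, S.card = n → ∀ σ : Equiv.Perm (Fin n),
      Finset.univ.image (fun i => Nat.nth (· ∈ S) (σ i)) = S := by
    intro S hS σ
    refine Finset.eq_of_subset_of_card_le ?_ ?_
    · intro v hv
      obtain ⟨i, _, rfl⟩ := Finset.mem_image.1 hv
      exact Nat.nth_mem_of_lt_card (finite_mem S) (lt_card hS _)
    · have := Finset.card_image_of_injective Finset.univ ((hinj hS).comp σ.injective)
      rw [Finset.card_univ, Fintype.card_fin] at this
      exact (hS.trans this.symm).le
  refine (Finset.sum_bij (fun z _ i => Nat.nth (· ∈ z.1) (z.2 i)) ?_ ?_ ?_ ?_).symm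
  · rintro ⟨S, σ⟩ h
    simp only [Finset.mem_product, Finset.mem_powersetCard, Finset.mem_univ, and_true] at h
    simp only [Finset.mem_filter, Fintype.mem_piFinset]
    exact ⟨fun i => h.1 (Nat.nth_mem_of_lt_card (finite_mem S) (lt_card h.2 _)),
      (hinj h.2).comp σ.injective⟩
  · rintro ⟨S, σ⟩ h ⟨S', σ'⟩ h' heq
    simp only [Finset.mem_product, Finset.mem_powersetCard, Finset.mem_univ, and_true] at h h'
    have hS : S = S' := by
      rw [← himg h.2 σ, ← himg h'.2 σ']
      exact congrArg (fun e => Finset.univ.image e) heq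
    subst hS
    have : σ = σ' := Equiv.ext fun i => hinj h.2 (congrFun heq i)
    rw [this]
  · intro e he
    simp only [Finset.mem_filter, Fintype.mem_piFinset] at he
    set S := Finset.univ.image e with hS
    have hcard : S.card = n := by rw [hS, Finset.card_image_of_injective _ he.2]; simp
    have hmem : ∀ i, e i ∈ S := fun i => Finset.mem_image_of_mem _ (Finset.mem_univ i)
    have hlt : ∀ i, Nat.count (· ∈ S) (e i) < n := fun i => by
      have := Nat.count_lt_card (p := (· ∈ S)) (finite_mem S) (hmem i)
      exact this.trans_eq ((card_finite_mem S).trans hcard)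
    have hσ : Function.Injective fun i => (⟨Nat.count (· ∈ S) (e i), hlt i⟩ : Fin n) := by
      intro i j hij
      exact he.2 (Nat.count_injective (p := (· ∈ S)) (hmem i) (hmem j) (Fin.mk.inj_iff.1 hij))
    refine ⟨(S, Equiv.ofBijective _ (Finite.injective_iff_bijective.1 hσ)), ?_, ?_⟩
    · simp only [Finset.mem_product, Finset.mem_powersetCard, Finset.mem_univ, and_true]
      refine ⟨?_, hcard⟩
      intro v hv
      obtain ⟨i, _, rfl⟩ := Finset.mem_image.1 hv
      exact he.1 i
    · funext i
      simp [Nat.nth_count (p := (· ∈ S)) (hmem i)]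
  · intro z _; rfl

/-- The number of `n`-element subsets of `V` in which `x` and `y` occupy the positions `r`
and `r'`. -/
noncomputable def positionCount (V : Finset ℕ) (n x y r r' : ℕ) : ℕ :=
  ((V.powersetCard n).filter fun S =>
    (x ∈ S ∧ (S.filter (· < x)).card = r) ∧ (y ∈ S ∧ (S.filter (· < y)).card = r')).card

lemma positionCount_comm (V : Finset ℕ) (n x y r r' : ℕ) :
    positionCount V n x y r r' = positionCount V n y x r' r := by
  simp only [positionCount, and_comm (a := _ ∈ _ ∧ (Finset.filter (· < x) _).card = _)]

theorem injWalkMatrix_eq (ν : ℂ) (V : Finset ℕ) (t x y : ℕ) :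
    injWalkMatrix ν V t x y = ∑ σ : Equiv.Perm (Fin (t + 2)),
      pathWeight ν (fun i => (σ i : ℕ))
        * positionCount V (t + 2) x y (σ 0) (σ (Fin.last _)) := by
  classical
  rw [injWalkMatrix, sum_injective, Finset.sum_comm]
  refine Finset.sum_congr rfl fun σ _ => ?_
  rw [positionCount, Finset.card_filter, Nat.cast_sum, Finset.mul_sum]
  refine Finset.sum_congr rfl fun S hS => ?_
  have hcard := (Finset.mem_powersetCard.1 hS).2
  have lt_card : ∀ i : Fin (t + 2), (i : ℕ) < (finite_mem S).toFinset.card := by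
    intro i; rw [card_finite_mem, hcard]; exact i.2
  have hpos : ∀ (i : Fin (t + 2)) (z : ℕ),
      Nat.nth (· ∈ S) i = z ↔ z ∈ S ∧ (S.filter (· < z)).card = i := by
    intro i z
    rw [← count_mem_eq]
    constructor
    · rintro rfl
      exact ⟨Nat.nth_mem_of_lt_card (finite_mem S) (lt_card i),
        Nat.count_nth_of_lt_card_finite (finite_mem S) (lt_card i)⟩
    · rintro ⟨h1, h2⟩
      rw [← h2, Nat.nth_count (p := (· ∈ S)) h1]
  have hpw : pathWeight ν (fun i => Nat.nth (· ∈ S) (σ i))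
      = pathWeight ν (fun i => (σ i : ℕ)) :=
    pathWeight_congr ν fun i j =>
      (Nat.nth_strictMonoOn (finite_mem S)).lt_iff_lt (lt_card _) (lt_card _)
  simp only [hpos, hpw, Nat.cast_ite, Nat.cast_one, Nat.cast_zero, mul_ite, mul_one, mul_zero]

lemma card_split (S : Finset ℕ) (x y : ℕ) (hxy : x < y) (hx : x ∈ S) (hy : y ∈ S) :
    (S.filter (· < y)).card
        = (S.filter (· < x)).card + 1 + (S.filter fun v => x < v ∧ v < y).card ∧
      S.card = (S.filter (· < y)).card + 1 + (S.filter (y < ·)).card := by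
  have h1 : (S.filter (· = x)).card = 1 := by
    rw [Finset.card_eq_one]; exact ⟨x, by ext; simp; rintro rfl; exact hx⟩
  have h2 : (S.filter (· = y)).card = 1 := by
    rw [Finset.card_eq_one]; exact ⟨y, by ext; simp; rintro rfl; exact hy⟩
  -- The 1 in the first identity becomes the number of v = x, the 1 in the second the number of v =
  -- y; both are then sums of indicators over `S`, compared term by term.
  rw [← h1]
  nth_rewrite 2 [h1]
  rw [← h2]
  rw [Finset.card_eq_sum_ones S]
  simp only [Finset.card_filter, ← Finset.sum_add_distrib]
  constructor <;> refine Finset.sum_congr rfl fun v _ => ?_ <;> split_ifs <;> omega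

/-- The set is x and y together with independent choices of its parts below x, between x and y, and
above y. The bound on `r'` keeps `n - 1 - r'` from being truncated. -/
theorem positionCount_of_lt (N n x y r r' : ℕ) (hx : 1 ≤ x) (hxy : x < y) (hy : y ≤ N)
    (hr' : r' < n) :
    positionCount (Finset.Icc 1 N) n x y r r' = if r < r' then
      (x - 1).choose r * (y - x - 1).choose (r' - r - 1) * (N - y).choose (n - 1 - r')
      else 0 := by
  split_ifs with hr
  · have : (x - 1).choose r * (y - x - 1).choose (r' - r - 1) * (N - y).choose (n - 1 - r')
        = ((Finset.powersetCard r (Finset.Ico 1 x) ×ˢ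
            Finset.powersetCard (r' - r - 1) (Finset.Ioo x y)) ×ˢ
            Finset.powersetCard (n - 1 - r') (Finset.Ioc y N)).card := by
      simp only [Finset.card_product, Finset.card_powersetCard, Nat.card_Ico, Nat.card_Ioo,
        Nat.card_Ioc]
    rw [this, positionCount]
    refine Finset.card_nbij'
      (fun S => ((S.filter (· < x), S.filter fun v => x < v ∧ v < y), S.filter (y < ·)))
      (fun A => insert x (insert y (A.1.1 ∪ A.1.2 ∪ A.2))) ?_ ?_ ?_ ?_
    · intro S hS
      simp only [Finset.coe_filter, Set.mem_ofPred_eq, Finset.mem_powersetCard] at hS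
      obtain ⟨⟨hSV, hSc⟩, ⟨hxS, h1⟩, hyS, h2⟩ := hS
      obtain ⟨c1, c2⟩ := card_split S x y hxy hxS hyS
      have hV : ∀ v ∈ S, 1 ≤ v ∧ v ≤ N := fun v hv => Finset.mem_Icc.1 (hSV hv)
      simp only [Finset.coe_product, Set.mem_prod, Finset.mem_coe, Finset.mem_powersetCard]
      refine ⟨⟨⟨?_, h1⟩, ?_, by omega⟩, ?_, by omega⟩ <;> intro v hv <;>
        simp only [Finset.mem_filter] at hv <;>
        simp only [Finset.mem_Ico, Finset.mem_Ioo, Finset.mem_Ioc] <;>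
        have := hV v hv.1 <;> omega
    · rintro ⟨⟨A, B⟩, C⟩ h
      simp only [Finset.coe_product, Set.mem_prod, Finset.mem_coe, Finset.mem_powersetCard] at h
      obtain ⟨⟨⟨hA, a1⟩, hB, b1⟩, hC, c1⟩ := h
      have hA' : ∀ v ∈ A, 1 ≤ v ∧ v < x := fun v hv => Finset.mem_Ico.1 (hA hv)
      have hB' : ∀ v ∈ B, x < v ∧ v < y := fun v hv => Finset.mem_Ioo.1 (hB hv)
      have hC' : ∀ v ∈ C, y < v ∧ v ≤ N := fun v hv => Finset.mem_Ioc.1 (hC hv)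
      set T : Finset ℕ := insert x (insert y (A ∪ B ∪ C)) with hT
      have hmem : ∀ v, v ∈ T ↔ v = x ∨ v = y ∨ v ∈ A ∨ v ∈ B ∨ v ∈ C := by
        intro v; simp [hT]
      have eA : T.filter (· < x) = A := by
        ext v; rw [Finset.mem_filter, hmem]
        have := hA' v; have := hB' v; have := hC' v; grind
      have eB : (T.filter fun v => x < v ∧ v < y) = B := by
        ext v; rw [Finset.mem_filter, hmem]
        have := hA' v; have := hB' v; have := hC' v; grind
      have eC : T.filter (y < ·) = C := by
        ext v; rw [Finset.mem_filter, hmem]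
        have := hA' v; have := hB' v; have := hC' v; grind
      have hxT : x ∈ T := by simp [hT]
      have hyT : y ∈ T := by simp [hT]
      obtain ⟨k1, k2⟩ := card_split T x y hxy hxT hyT
      rw [eA, eB] at k1
      rw [eC] at k2
      simp only [Finset.coe_filter, Set.mem_ofPred_eq, Finset.mem_powersetCard]
      rw [← hT]
      refine ⟨⟨?_, by omega⟩, ⟨hxT, by rw [eA, a1]⟩, hyT, by omega⟩
      intro v hv
      rw [hmem] at hv
      rw [Finset.mem_Icc]
      have := hA' v; have := hB' v; have := hC' v; grind
    · intro S hS
      simp only [Finset.coe_filter, Set.mem_ofPred_eq, Finset.mem_powersetCard] at hS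
      obtain ⟨-, ⟨hxS, -⟩, hyS, -⟩ := hS
      ext v
      simp only [Finset.mem_insert, Finset.mem_union, Finset.mem_filter]
      grind
    · rintro ⟨⟨A, B⟩, C⟩ h
      simp only [Finset.coe_product, Set.mem_prod, Finset.mem_coe, Finset.mem_powersetCard] at h
      obtain ⟨⟨⟨hA, a1⟩, hB, b1⟩, hC, c1⟩ := h
      have hA' : ∀ v ∈ A, 1 ≤ v ∧ v < x := fun v hv => Finset.mem_Ico.1 (hA hv)
      have hB' : ∀ v ∈ B, x < v ∧ v < y := fun v hv => Finset.mem_Ioo.1 (hB hv)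
      have hC' : ∀ v ∈ C, y < v ∧ v ≤ N := fun v hv => Finset.mem_Ioc.1 (hC hv)
      simp only [Prod.mk.injEq]
      refine ⟨⟨?_, ?_⟩, ?_⟩ <;> ext v <;>
        simp only [Finset.mem_filter, Finset.mem_insert, Finset.mem_union] <;>
        have := hA' v <;> have := hB' v <;> have := hC' v <;> grind
  · rw [positionCount, Finset.card_eq_zero, Finset.filter_eq_empty_iff]
    rintro S - ⟨⟨hxS, h1⟩, hyS, h2⟩
    have := (card_split S x y hxy hxS hyS).1
    omega

/-! ### Scaling limits of the counts and of the walk matrix. -/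

lemma tendsto_choose_mul_pow {n : ℕ → ℕ} {h : ℕ → ℝ} {ξ : ℝ}
    (hn : Tendsto (fun N => (n N : ℝ) * h N) atTop (𝓝 ξ)) (hh : Tendsto h atTop (𝓝 0)) (m : ℕ) :
    Tendsto (fun N => ((n N).choose m : ℝ) * h N ^ m) atTop (𝓝 (ξ ^ m / m.factorial)) := by
  induction m with
  | zero => simp
  | succ m ih =>
    -- Replacing n by the truncated n - m changes the scaled value by at most m|h|, which tends to
    -- 0.
    have hsub : Tendsto (fun N => ((n N - m : ℕ) : ℝ) * h N) atTop (𝓝 ξ) := by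
      have h1 : Tendsto (fun N => ((n N - m : ℕ) : ℝ) * h N - (n N : ℝ) * h N) atTop (𝓝 0) := by
        refine squeeze_zero_norm (a := fun N => (m : ℝ) * |h N|) (fun N => ?_) ?_
        · rw [← sub_mul, norm_mul, Real.norm_eq_abs, Real.norm_eq_abs]
          gcongr
          rcases le_total m (n N) with h | h
          · rw [Nat.cast_sub h, abs_le]; constructor <;> linarith [Nat.cast_nonneg (α := ℝ) m]
          · rw [Nat.sub_eq_zero_of_le h, Nat.cast_zero, zero_sub, abs_neg, Nat.abs_cast]
            exact_mod_cast h
        · simpa using hh.abs.const_mul (m : ℝ)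
      simpa using h1.add hn
    have := (ih.mul hsub).div_const ((m : ℝ) + 1)
    have e : ξ ^ (m + 1) / ((m + 1).factorial : ℝ) = ξ ^ m / m.factorial * ξ / (m + 1) := by
      rw [Nat.factorial_succ]; push_cast; field_simp; ring
    rw [e]
    refine this.congr fun N => ?_
    have hc : ((n N).choose (m + 1) : ℝ) * (m + 1) = (n N).choose m * ((n N - m : ℕ) : ℝ) := by
      exact_mod_cast Nat.choose_succ_right_eq (n N) m
    rw [div_eq_iff (by positivity), pow_succ]
    linear_combination (-(h N ^ m * h N)) * hc

/-- The index of the interval of the equipartition that contains `x`. -/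
noncomputable def gridIndex (a b : ℝ) (N : ℕ) (x : ℝ) : ℕ := ⌊(x - a) / (b - a) * N⌋₊ + 1

section Limits

variable {a b x y : ℝ}

lemma gridIndex_mem (hx : x ∈ Ico a b) {N : ℕ} (hN : 0 < N) :
    gridIndex a b N x ∈ Finset.Icc 1 N := by
  have hab : 0 < b - a := by linarith [hx.1, hx.2]
  have hN' : (0 : ℝ) < N := by exact_mod_cast hN
  have h0 : 0 ≤ (x - a) / (b - a) * N :=
    mul_nonneg (div_nonneg (by linarith [hx.1]) hab.le) hN'.le
  have h1 : (x - a) / (b - a) * N < N := by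
    have : (x - a) / (b - a) < 1 := by rw [div_lt_one hab]; linarith [hx.2]
    nlinarith
  have := (Nat.floor_lt h0).2 h1
  rw [Finset.mem_Icc, gridIndex]; omega

lemma tendsto_step : Tendsto (fun N : ℕ => (b - a) / (N : ℝ)) atTop (𝓝 0) :=
  tendsto_const_div_atTop_nhds_zero_nat _

lemma tendsto_gridIndex (hx : x ∈ Ico a b) :
    Tendsto (fun N : ℕ => (gridIndex a b N x : ℝ) * ((b - a) / N)) atTop (𝓝 (x - a)) := by
  have hab : 0 < b - a := by linarith [hx.1, hx.2]
  have h1 := (tendsto_nat_floor_mul_div_atTop (R := ℝ) (a := (x - a) / (b - a))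
    (div_nonneg (by linarith [hx.1]) hab.le)).comp tendsto_natCast_atTop_atTop
  have h2 := (h1.mul_const (b - a)).add (tendsto_step (a := a) (b := b))
  rw [div_mul_cancel₀ _ hab.ne', add_zero] at h2
  refine h2.congr fun N => ?_
  simp only [gridIndex, Function.comp]
  push_cast
  ring

lemma eventually_gridIndex_lt (hx : x ∈ Ico a b) (hy : y ∈ Ico a b) (hxy : x < y) :
    ∀ᶠ N : ℕ in atTop, gridIndex a b N x < gridIndex a b N y := by
  have hab : 0 < b - a := by linarith [hx.1, hx.2]
  have h := (tendsto_gridIndex hx).eventually_lt (tendsto_gridIndex hy) (by linarith)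
  filter_upwards [h, eventually_gt_atTop 0] with N hN hN0
  have : 0 < (b - a) / (N : ℝ) := div_pos hab (by exact_mod_cast hN0)
  exact_mod_cast lt_of_mul_lt_mul_right hN this.le

/-- The limit of `positionCount`, normalized, for `x < y`. -/
noncomputable def positionVolume (a b : ℝ) (t r r' : ℕ) (x y : ℝ) : ℝ :=
  if r < r' then bracket a b r (r' - r - 1) (t + 1 - r') x y else 0

lemma tendsto_positionCount (hx : x ∈ Ico a b) (hy : y ∈ Ico a b) (hxy : x < y) (t r r' : ℕ)
    (hr' : r' < t + 2) :
    Tendsto (fun N : ℕ => (positionCount (Finset.Icc 1 N) (t + 2) (gridIndex a b N x)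
      (gridIndex a b N y) r r' : ℝ) * ((b - a) / N) ^ t) atTop
        (𝓝 (positionVolume a b t r r' x y)) := by
  have hlt := eventually_gridIndex_lt hx hy hxy
  have hs : Tendsto (fun N : ℕ => (b - a) / (N : ℝ)) atTop (𝓝 0) := tendsto_step
  by_cases hr : r < r'
  · have l1 : Tendsto (fun N : ℕ => ((gridIndex a b N x - 1 : ℕ) : ℝ) * ((b - a) / N)) atTop
        (𝓝 (x - a)) := by
      have := (tendsto_gridIndex hx).sub hs
      rw [sub_zero] at this
      refine this.congr fun N => ?_
      rw [Nat.cast_sub (by simp [gridIndex])]; push_cast; ring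
    have l2 : Tendsto (fun N : ℕ =>
        ((gridIndex a b N y - gridIndex a b N x - 1 : ℕ) : ℝ) * ((b - a) / N)) atTop
        (𝓝 (y - x)) := by
      have := ((tendsto_gridIndex hy).sub (tendsto_gridIndex hx)).sub hs
      rw [sub_zero, sub_sub_sub_cancel_right] at this
      refine this.congr' ?_
      filter_upwards [hlt] with N hN
      rw [Nat.cast_sub (by omega), Nat.cast_sub hN.le]; push_cast; ring
    have l3 : Tendsto (fun N : ℕ => ((N - gridIndex a b N y : ℕ) : ℝ) * ((b - a) / N)) atTop
        (𝓝 (b - y)) := by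
      have := (tendsto_gridIndex hy).const_sub (b - a)
      rw [sub_sub_sub_cancel_right] at this
      refine this.congr' ?_
      filter_upwards [eventually_gt_atTop 0] with N hN
      have hN' : (N : ℝ) ≠ 0 := by exact_mod_cast hN.ne'
      rw [Nat.cast_sub (Finset.mem_Icc.1 (gridIndex_mem hy hN)).2]; field_simp
    have h := ((tendsto_choose_mul_pow l1 hs r).mul
      (tendsto_choose_mul_pow l2 hs (r' - r - 1))).mul
        (tendsto_choose_mul_pow l3 hs (t + 1 - r'))
    rw [positionVolume, if_pos hr, bracket]
    refine h.congr' ?_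
    filter_upwards [hlt, eventually_gt_atTop 0] with N hN hN0
    have m1 := Finset.mem_Icc.1 (gridIndex_mem hx hN0)
    have m2 := Finset.mem_Icc.1 (gridIndex_mem hy hN0)
    rw [positionCount_of_lt N (t + 2) _ _ r r' m1.1 hN m2.2 hr', if_pos hr,
      show t = r + (r' - r - 1) + (t + 1 - r') by omega, pow_add, pow_add,
      show r + (r' - r - 1) + (t + 1 - r') + 1 - r' = t + 1 - r' by omega,
      show r + (r' - r - 1) + (t + 1 - r') + 2 - 1 - r' = t + 1 - r' by omega]
    push_cast
    ring
  · rw [positionVolume, if_neg hr]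
    refine tendsto_const_nhds.congr' ?_
    filter_upwards [hlt, eventually_gt_atTop 0] with N hN hN0
    have m1 := Finset.mem_Icc.1 (gridIndex_mem hx hN0)
    have m2 := Finset.mem_Icc.1 (gridIndex_mem hy hN0)
    rw [positionCount_of_lt N (t + 2) _ _ r r' m1.1 hN m2.2 hr', if_neg hr]
    simp

/-- The kernel with `t + 1` factors, as a sum over the orderings of `t + 2` vertices. -/
noncomputable def orderingSum (a b : ℝ) (ν : ℂ) (t : ℕ) (x y : ℝ) : ℂ :=
  ∑ σ : Equiv.Perm (Fin (t + 2)), pathWeight ν (fun i => (σ i : ℕ)) *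
    ((if x < y then positionVolume a b t (σ 0) (σ (Fin.last _)) x y
      else positionVolume a b t (σ (Fin.last _)) (σ 0) y x : ℝ) : ℂ)

/-- The injective part is a finite sum over permutations of position counts, each converging to its
volume. The remainder is O(1/N), since off the diagonal the two grid indices are eventually
distinct. -/
theorem tendsto_walkMatrix (ν : ℂ) (t : ℕ) (hx : x ∈ Ico a b) (hy : y ∈ Ico a b) (hxy : x ≠ y) :
    Tendsto (fun N : ℕ => ((((b - a) / N : ℝ) : ℂ)) ^ t *
      walkMatrix ν (Finset.Icc 1 N) t (gridIndex a b N x) (gridIndex a b N y)) atTop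
      (𝓝 (orderingSum a b ν t x y)) := by
  have hab : 0 < b - a := by linarith [hx.1, hx.2]
  have h1 : Tendsto (fun N : ℕ => ((((b - a) / N : ℝ) : ℂ)) ^ t *
      injWalkMatrix ν (Finset.Icc 1 N) t (gridIndex a b N x) (gridIndex a b N y)) atTop
      (𝓝 (orderingSum a b ν t x y)) := by
    simp only [injWalkMatrix_eq, Finset.mul_sum, orderingSum]
    refine tendsto_finsetSum _ fun σ _ => ?_
    have hσ : Tendsto (fun N : ℕ => (positionCount (Finset.Icc 1 N) (t + 2) (gridIndex a b N x)
      (gridIndex a b N y) (σ 0) (σ (Fin.last _)) : ℝ) * ((b - a) / N) ^ t) atTop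
        (𝓝 (if x < y then positionVolume a b t (σ 0) (σ (Fin.last _)) x y
          else positionVolume a b t (σ (Fin.last _)) (σ 0) y x)) := by
      split_ifs with h
      · exact tendsto_positionCount hx hy h t _ _ (σ _).2
      · simp only [positionCount_comm _ _ (gridIndex a b _ x)]
        exact tendsto_positionCount hy hx (lt_of_le_of_ne (not_lt.1 h) hxy.symm) t _ _ (σ _).2
    have := ((Complex.continuous_ofReal.tendsto _).comp hσ).const_mul
      (pathWeight ν (fun i => (σ i : ℕ)))
    refine this.congr fun N => ?_
    simp only [Function.comp]
    push_cast
    ring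
  have h2 : Tendsto (fun N : ℕ => ((((b - a) / N : ℝ) : ℂ)) ^ t *
      (walkMatrix ν (Finset.Icc 1 N) t (gridIndex a b N x) (gridIndex a b N y)
        - injWalkMatrix ν (Finset.Icc 1 N) t (gridIndex a b N x) (gridIndex a b N y))) atTop
      (𝓝 0) := by
    have hlim := (tendsto_const_div_atTop_nhds_zero_nat
      (‖ν‖ ^ (t + 1) * (t * (t + 2) : ℕ) * (b - a) ^ t))
    refine squeeze_zero_norm' ?_ hlim
    have hne : ∀ᶠ N : ℕ in atTop, gridIndex a b N x ≠ gridIndex a b N y := by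
      rcases lt_or_gt_of_ne hxy with h | h
      · exact (eventually_gridIndex_lt hx hy h).mono fun _ => ne_of_lt
      · exact (eventually_gridIndex_lt hy hx h).mono fun _ => ne_of_gt
    filter_upwards [hne, eventually_gt_atTop 0] with N hN hN0
    have hN' : (0 : ℝ) < N := by exact_mod_cast hN0
    have hb := norm_walkMatrix_sub_inj_le ν (Finset.Icc 1 N) t _ _ (gridIndex_mem hx hN0) hN
    rw [Nat.card_Icc, Nat.add_sub_cancel] at hb
    rw [norm_mul, norm_pow, Complex.norm_real, Real.norm_of_nonneg (by positivity),
      le_div_iff₀ hN', div_pow, mul_assoc]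
    calc _ ≤ (b - a) ^ t / (N : ℝ) ^ t * (‖ν‖ ^ (t + 1) * (t * (t + 2) : ℕ) * (N : ℝ) ^ t) := by
          gcongr
      _ = _ := by field_simp
  have := h2.add h1
  rw [zero_add] at this
  refine this.congr fun N => by ring

end Limits

/-! ### Linear extensions as permutations. -/

/-- `e_i < e_{i+2}` for all `i`. -/
def IsShuffle {t : ℕ} (σ : Fin (t + 2) → Fin (t + 2)) : Prop :=
  ∀ i : Fin t, σ i.castSucc.castSucc < σ i.succ.succ

/-- The number of ascents of a sequence. -/
def ascentCount {t : ℕ} (σ : Fin (t + 2) → Fin (t + 2)) : ℕ :=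
  (Finset.univ.filter fun i : Fin (t + 1) => σ i.castSucc < σ i.succ).card

/-- The path of a sequence of essential coordinates. -/
def pathOf {t : ℕ} (σ : Fin (t + 2) → Fin (t + 2)) (i : Fin (t + 1)) : Bool :=
  decide (σ i.castSucc < σ i.succ)

/-- The array of pairs of a sequence of essential coordinates. -/
def arrayOf {t : ℕ} (σ : Fin (t + 2) → Fin (t + 2)) (i : Fin (t + 1)) :
    Fin (t + 2) × Fin (t + 2) :=
  if σ i.castSucc < σ i.succ then (σ i.castSucc, σ i.succ) else (σ i.succ, σ i.castSucc)

lemma essCoord_pathOf {t : ℕ} (σ : Fin (t + 2) → Fin (t + 2)) :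
    essCoord (pathOf σ) (arrayOf σ) = σ := by
  funext i
  induction i using Fin.cases with
  | zero =>
    simp only [essCoord, Fin.cons_zero, pathOf, arrayOf]
    by_cases h : σ 0 < σ 1
    · simp [h]
    · simp [h]
  | succ i =>
    simp only [essCoord, Fin.cons_succ, pathOf, arrayOf]
    by_cases h : σ i.castSucc < σ i.succ
    · simp [h]
    · simp [h]

section Extension

variable {t : ℕ} {π : Fin (t + 1) → Bool} {p : Fin (t + 1) → Fin (t + 2) × Fin (t + 2)}

lemma essCoord_succ (i : Fin (t + 1)) :
    essCoord π p i.succ = if π i then (p i).2 else (p i).1 := by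
  simp [essCoord]

/-- The equalities in `EdgeRel` say that the ket label of each vertex is the bra label of the
preceding one; this is the chaining of the matrix units. -/
lemma essCoord_castSucc (hp : MemOmega π p) (i : Fin (t + 1)) :
    essCoord π p i.castSucc = if π i then (p i).1 else (p i).2 := by
  induction i using Fin.cases with
  | zero => simp [essCoord]
  | succ i =>
    have h := hp.2 i
    rw [← Fin.succ_castSucc, essCoord_succ]
    cases h1 : π i.castSucc <;> cases h2 : π i.succ <;> simp only [h1, h2, EdgeRel] at h <;>
      simp [h]

lemma essCoord_castSucc_lt_iff (hp : MemOmega π p) (i : Fin (t + 1)) :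
    essCoord π p i.castSucc < essCoord π p i.succ ↔ π i = true := by
  rw [essCoord_castSucc hp, essCoord_succ]
  have := hp.1 i
  cases h : π i <;> simp [this, this.le]

lemma pathOf_essCoord (hp : MemOmega π p) : pathOf (essCoord π p) = π := by
  funext i
  simp only [pathOf, essCoord_castSucc_lt_iff hp]
  cases π i <;> rfl

lemma arrayOf_essCoord (hp : MemOmega π p) : arrayOf (essCoord π p) = p := by
  funext i
  rw [arrayOf, if_congr (essCoord_castSucc_lt_iff hp i) rfl rfl, essCoord_castSucc hp,
    essCoord_succ]
  cases h : π i <;> simp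

lemma isShuffle_essCoord (hp : MemOmega π p) : IsShuffle (essCoord π p) := by
  intro i
  have h := hp.2 i
  have h3 := hp.1 i.castSucc
  rw [essCoord_castSucc hp, essCoord_succ]
  cases h1 : π i.castSucc <;> cases h2 : π i.succ <;> simp only [h1, h2, EdgeRel] at h <;>
    simp
  · exact h.2.2
  · exact h.1
  · exact h.1.trans (h.2.1 ▸ h.2.2)

/-- Two consecutive descents would give σ(i+2) < σ(i), so the ascent pattern is a path. In each
remaining case the edge relation is the shuffle inequality joined to the two step comparisons. -/
lemma memOmega_of_isShuffle {σ : Fin (t + 2) → Fin (t + 2)} (hσ : Function.Injective σ)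
    (hs : IsShuffle σ) : IsPath (pathOf σ) ∧ MemOmega (pathOf σ) (arrayOf σ) := by
  have hne : ∀ i : Fin (t + 1), σ i.castSucc ≠ σ i.succ := fun i h =>
    (Fin.castSucc_lt_succ (i := i)).ne (hσ h)
  refine ⟨?_, ?_, ?_⟩
  · rintro i ⟨h1, h2⟩
    simp only [pathOf, decide_eq_false_iff_not, not_lt] at h1 h2
    rw [← Fin.succ_castSucc] at h2
    exact absurd (h2.trans h1) (not_le.2 (hs i))
  · intro i
    rw [arrayOf]
    split_ifs with h
    · exact h
    · exact lt_of_le_of_ne (not_lt.1 h) (hne i).symm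
  · intro i
    have h := hs i
    have h1 := hne i.castSucc
    have h2 := hne i.succ
    simp only [pathOf, arrayOf, ← Fin.succ_castSucc] at h1 h2 ⊢
    by_cases c1 : σ i.castSucc.castSucc < σ i.castSucc.succ <;>
      by_cases c2 : σ i.castSucc.succ < σ i.succ.succ <;> simp only [c1, c2, EdgeRel] <;>
      simp <;> grind

end Extension

lemma rankLeft_pathOf {t : ℕ} (σ : Equiv.Perm (Fin (t + 2))) :
    rankLeft (pathOf σ) (arrayOf σ) = σ 0 := by
  rw [rankLeft, essCoord_pathOf]
  have := Finset.card_bijective (s := Finset.univ.filter fun i => σ i < σ 0)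
    (t := Finset.Iio (σ 0)) σ σ.bijective (by simp)
  rw [this, Fin.card_Iio]

lemma rankRight_pathOf {t : ℕ} (σ : Equiv.Perm (Fin (t + 2))) :
    rankRight (pathOf σ) (arrayOf σ) = t + 1 - σ (Fin.last _) := by
  rw [rankRight, essCoord_pathOf]
  have := Finset.card_bijective (s := Finset.univ.filter fun i => σ (Fin.last _) < σ i)
    (t := Finset.Ioi (σ (Fin.last _))) σ σ.bijective (by simp)
  rw [this, Fin.card_Ioi]
  omega

lemma upperCount_pathOf {t : ℕ} (σ : Fin (t + 2) → Fin (t + 2)) :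
    upperCount (pathOf σ) = ascentCount σ := by
  simp [upperCount, ascentCount, pathOf]

-- The essential coordinates of a linear extension form a permutation, and `pathOf`, `arrayOf`
-- recover the path and the array from it.
open Classical in
theorem extensionCount_eq (t q r r' : ℕ) :
    extensionCount t q r r' = (Finset.univ.filter fun σ : Equiv.Perm (Fin (t + 2)) =>
      IsShuffle σ ∧ ascentCount σ = q ∧ (σ 0 : ℕ) = r ∧ t + 1 - (σ (Fin.last _) : ℕ) = r').card := by
  rw [extensionCount, ← Fintype.card_subtype, ← Nat.card_eq_fintype_card]
  symm
  refine Nat.card_congr (Equiv.ofBijective (fun σ => ⟨(pathOf σ.1, arrayOf σ.1), ?_⟩) ⟨?_, ?_⟩)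
  · obtain ⟨σ, h1, h2, h3, h4⟩ := σ
    obtain ⟨h5, h6⟩ := memOmega_of_isShuffle σ.injective h1
    refine ⟨h5, by rw [upperCount_pathOf, h2], ⟨h6, ?_⟩, by rw [rankLeft_pathOf, h3],
      by rw [rankRight_pathOf, h4]⟩
    rw [essCoord_pathOf]
    exact σ.injective
  · intro σ σ' h
    simp only [Subtype.mk.injEq, Prod.mk.injEq] at h
    have := essCoord_pathOf (σ : Equiv.Perm (Fin (t + 2)))
    rw [h.1, h.2, essCoord_pathOf] at this
    exact Subtype.ext (Equiv.ext (congrFun this.symm))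
  · rintro ⟨⟨π, p⟩, h1, h2, ⟨h3, h4⟩, h5, h6⟩
    simp only at h1 h2 h3 h4 h5 h6
    set σ : Equiv.Perm (Fin (t + 2)) :=
      Equiv.ofBijective (essCoord π p) (Finite.injective_iff_bijective.1 h4)
    have hσ : (σ : Fin (t + 2) → Fin (t + 2)) = essCoord π p := rfl
    have e1 : pathOf σ = π := by rw [hσ, pathOf_essCoord h3]
    have e2 : arrayOf σ = p := by rw [hσ, arrayOf_essCoord h3]
    refine ⟨⟨σ, isShuffle_essCoord h3, ?_, ?_, ?_⟩, ?_⟩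
    · rw [← upperCount_pathOf, e1, h2]
    · rw [← rankLeft_pathOf, e1, e2, h5]
    · rw [← rankRight_pathOf, e1, e2, h6]
    · simp only [e1, e2]

lemma pathWeight_perm (ν : ℂ) {t : ℕ} (σ : Equiv.Perm (Fin (t + 2))) [Decidable (IsShuffle σ)] :
    pathWeight ν (fun i => (σ i : ℕ)) = if IsShuffle σ then
      (-(starRingEnd ℂ) ν) ^ ascentCount σ * ν ^ (t + 1 - ascentCount σ) else 0 := by
  have hne : ∀ i : Fin (t + 1), σ i.castSucc ≠ σ i.succ := fun i h =>
    (Fin.castSucc_lt_succ (i := i)).ne (σ.injective h)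
  have h1 : ∀ i : Fin (t + 1), stepWeight ν (σ i.castSucc : ℕ) (σ i.succ : ℕ)
      = if σ i.castSucc < σ i.succ then -(starRingEnd ℂ) ν else ν := by
    intro i
    rw [stepWeight]
    simp only [Fin.val_fin_lt]
    split_ifs with h1 h2
    · rfl
    · rfl
    · exact absurd (le_antisymm (not_lt.1 h2) (not_lt.1 h1)) (hne i)
  have h2 : (Finset.univ.filter fun i : Fin (t + 1) => ¬ σ i.castSucc < σ i.succ).card
      = t + 1 - ascentCount σ := by
    have := Finset.card_filter_add_card_filter_not (s := (Finset.univ : Finset (Fin (t + 1))))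
      (fun i => σ i.castSucc < σ i.succ)
    rw [Finset.card_univ, Fintype.card_fin] at this
    rw [ascentCount]
    omega
  rw [pathWeight]
  simp only [h1, Finset.prod_ite, Finset.prod_const, h2, Fin.val_fin_lt]
  rw [← ascentCount]
  by_cases h : IsShuffle σ
  · rw [if_pos h, if_pos (by exact h), mul_one]
  · rw [if_neg h, if_neg (by exact h), mul_zero]

/-! ### The kernels f_s and g_s as sums over permutations. -/

open Classical in
lemma sum_extensionCount (ν : ℂ) (t r r' : ℕ) :
    ∑ q ∈ Finset.range (t + 1 + 1),
        (extensionCount t q r r' : ℂ) * (-(starRingEnd ℂ) ν) ^ q * ν ^ (t + 1 - q)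
      = ∑ σ : Equiv.Perm (Fin (t + 2)),
          if (σ 0 : ℕ) = r ∧ t + 1 - (σ (Fin.last _) : ℕ) = r' then
            pathWeight ν (fun i => (σ i : ℕ)) else 0 := by
  simp only [extensionCount_eq, Finset.card_filter, Nat.cast_sum, Finset.sum_mul]
  rw [Finset.sum_comm]
  refine Finset.sum_congr rfl fun σ _ => ?_
  rw [pathWeight_perm]
  have hle : ascentCount σ < t + 1 + 1 := by
    have := Finset.card_le_univ (Finset.univ.filter fun i : Fin (t + 1) =>
      σ i.castSucc < σ i.succ)
    rw [Fintype.card_fin] at this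
    rw [ascentCount]; omega
  rw [Finset.sum_eq_single (ascentCount σ)]
  · by_cases h1 : IsShuffle σ <;> simp [h1]
  · intro q _ hq; simp [hq.symm]
  · intro h; simp [hle] at h

lemma sum_triple (t m₀ n₀ p₀ : ℕ) (h : m₀ + n₀ + p₀ = t) (G : ℕ → ℕ → ℕ → ℂ) :
    ∑ m ∈ Finset.range (t + 1), ∑ n ∈ Finset.range (t + 1), ∑ p ∈ Finset.range (t + 1),
      (if m = m₀ ∧ n = n₀ ∧ p = p₀ then G m n p else 0) = G m₀ n₀ p₀ := by
  rw [Finset.sum_eq_single_of_mem m₀ (by simp; omega) (by intro m _ hm; simp [hm]),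
    Finset.sum_eq_single_of_mem n₀ (by simp; omega) (by intro m _ hm; simp [hm]),
    Finset.sum_eq_single_of_mem p₀ (by simp; omega) (by intro m _ hm; simp [hm])]
  simp

/-- Covers f and g together: `ρ` and `ρ'` are the ranks of the endpoints at the smaller and the
larger argument, and `hR` says that σ contributes to exactly one triple (m,n,p) when ρ < ρ', and to
none otherwise. -/
lemma sum_kernel_general (a b : ℝ) (ν : ℂ) (t : ℕ) (x y : ℝ) (R R' : ℕ → ℕ → ℕ → ℕ)
    (ρ ρ' : Equiv.Perm (Fin (t + 2)) → Fin (t + 2))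
    (hR : ∀ σ m n p, m + n + p = t → (((σ 0 : ℕ) = R m n p ∧
      t + 1 - (σ (Fin.last _) : ℕ) = R' m n p) ↔
        (ρ σ : ℕ) < ρ' σ ∧ m = ρ σ ∧ n = ρ' σ - ρ σ - 1 ∧ p = t + 1 - ρ' σ)) :
    (∑ m ∈ Finset.range (t + 1), ∑ n ∈ Finset.range (t + 1), ∑ p ∈ Finset.range (t + 1),
      if m + n + p + 1 = t + 1 then
        ∑ q ∈ Finset.range (t + 1 + 1), (extensionCount (m + n + p) q (R m n p) (R' m n p) : ℂ)
          * (-(starRingEnd ℂ) ν) ^ q * ν ^ (t + 1 - q) * (bracket a b m n p x y : ℂ)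
      else 0)
      = ∑ σ : Equiv.Perm (Fin (t + 2)), pathWeight ν (fun i => (σ i : ℕ))
          * (positionVolume a b t (ρ σ) (ρ' σ) x y : ℂ) := by
  have e1 : ∀ m n p : ℕ, (if m + n + p + 1 = t + 1 then
        ∑ q ∈ Finset.range (t + 1 + 1), (extensionCount (m + n + p) q (R m n p) (R' m n p) : ℂ)
          * (-(starRingEnd ℂ) ν) ^ q * ν ^ (t + 1 - q) * (bracket a b m n p x y : ℂ) else 0)
      = ∑ σ : Equiv.Perm (Fin (t + 2)), if (ρ σ : ℕ) < ρ' σ then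
          (if m = ρ σ ∧ n = ρ' σ - ρ σ - 1 ∧ p = t + 1 - ρ' σ then
            pathWeight ν (fun i => (σ i : ℕ)) * (bracket a b m n p x y : ℂ) else 0) else 0 := by
    intro m n p
    split_ifs with h
    · have h' : m + n + p = t := by omega
      rw [← Finset.sum_mul, h', sum_extensionCount, Finset.sum_mul]
      refine Finset.sum_congr rfl fun σ _ => ?_
      rw [if_congr (hR σ m n p h') rfl rfl, ← ite_and, ite_mul, zero_mul]
    · refine (Finset.sum_eq_zero fun σ _ => ?_).symm
      split_ifs with h1 h2
      · have := (ρ' σ).2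
        omega
      · rfl
      · rfl
  simp only [e1]
  rw [Finset.sum_congr rfl fun m _ => Finset.sum_congr rfl fun n _ => Finset.sum_comm,
    Finset.sum_congr rfl fun m _ => Finset.sum_comm, Finset.sum_comm]
  refine Finset.sum_congr rfl fun σ _ => ?_
  have := (ρ' σ).2
  rw [positionVolume]
  split_ifs with h
  · rw [sum_triple t _ _ _ (by omega) fun m n p =>
      pathWeight ν (fun i => (σ i : ℕ)) * (bracket a b m n p x y : ℂ)]
  · simp

theorem f_eq (a b : ℝ) (ν : ℂ) (t : ℕ) (x y : ℝ) :
    f a b ν (t + 1) x y = ∑ σ : Equiv.Perm (Fin (t + 2)), pathWeight ν (fun i => (σ i : ℕ))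
      * (positionVolume a b t (σ 0) (σ (Fin.last _)) x y : ℂ) :=
  sum_kernel_general a b ν t x y (fun m _ _ => m) (fun _ _ p => p) (fun σ => σ 0)
    (fun σ => σ (Fin.last _)) fun σ m n p h => by
      have := (σ (Fin.last _)).2
      have := (σ 0).2
      constructor <;> intro h' <;> omega

/-- With m + n + p = t, the rank (m+n+1, n+p+1) means that the last vertex has rank m and the first
has rank m + n + 1: the endpoints are in reverse order. -/
theorem g_eq (a b : ℝ) (ν : ℂ) (t : ℕ) (x y : ℝ) :
    g a b ν (t + 1) x y = ∑ σ : Equiv.Perm (Fin (t + 2)), pathWeight ν (fun i => (σ i : ℕ))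
      * (positionVolume a b t (σ (Fin.last _)) (σ 0) y x : ℂ) :=
  sum_kernel_general a b ν t y x (fun m n _ => m + n + 1) (fun _ n p => n + p + 1)
    (fun σ => σ (Fin.last _)) (fun σ => σ 0) fun σ m n p h => by
      have := (σ (Fin.last _)).2
      have := (σ 0).2
      constructor <;> intro h' <;> omega

theorem kernel_eq_orderingSum (a b : ℝ) (ν : ℂ) (t : ℕ) {x y : ℝ} (hx : x ∈ Ico a b)
    (hy : y ∈ Ico a b) (hxy : x ≠ y) :
    kernel a b ν (t + 1) x y = orderingSum a b ν t x y := by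
  rw [kernel, orderingSum]
  rcases lt_or_gt_of_ne hxy with h | h
  · rw [if_pos ⟨hx.1, h, hy.2⟩, if_neg (by rintro ⟨-, h', -⟩; exact absurd h h'.not_gt), add_zero,
      f_eq]
    simp [h]
  · rw [if_neg (by rintro ⟨-, h', -⟩; exact absurd h h'.not_gt), if_pos ⟨hy.1, h, hx.2⟩, zero_add,
      g_eq]
    simp [h.not_gt]

/-! ### Integral operators with bounded kernels -/

lemma L2.integrable {a b : ℝ} (h : L2 a b) : Integrable h (volume.restrict (Ico a b)) :=
  (Lp.memLp h).integrable (by norm_num)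

lemma exists_integral_norm_le (a b : ℝ) :
    ∃ A : ℝ, 0 ≤ A ∧ ∀ h : L2 a b, ∫ y in Ico a b, ‖h y‖ ≤ A * ‖h‖ := by
  refine ⟨((volume.restrict (Ico a b)) Set.univ
    ^ (1 / (1 : ENNReal).toReal - 1 / (2 : ENNReal).toReal)).toReal, ENNReal.toReal_nonneg,
    fun h => ?_⟩
  have hfin : (volume.restrict (Ico a b)) Set.univ
      ^ (1 / (1 : ENNReal).toReal - 1 / (2 : ENNReal).toReal) ≠ ⊤ :=
    ENNReal.rpow_ne_top_of_nonneg (by norm_num) (measure_ne_top _ _)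
  rw [integral_norm_eq_lintegral_enorm (Lp.aestronglyMeasurable h), ← eLpNorm_one_eq_lintegral_enorm,
    mul_comm, Lp.norm_def, ← ENNReal.toReal_mul]
  exact ENNReal.toReal_mono (ENNReal.mul_ne_top (Lp.eLpNorm_ne_top h) hfin)
    (eLpNorm_le_eLpNorm_mul_rpow_measure_univ (by norm_num) (Lp.aestronglyMeasurable h))

/-- On a finite measure space L² embeds in L¹ and bounded functions embed in L². The constant `A` is
chosen before the kernel, so summable kernel bounds yield a norm-summable series of operators. -/
theorem exists_isIntegralOperator (a b : ℝ) : ∃ A : ℝ, 0 ≤ A ∧ ∀ (K : ℝ → ℝ → ℂ) (C : ℝ), 0 ≤ C →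
    Measurable (Function.uncurry K) → (∀ x y, ‖K x y‖ ≤ C) →
    ∃ T : L2 a b →L[ℂ] L2 a b, IsIntegralOperator a b K T ∧ ‖T‖ ≤ C * A := by
  obtain ⟨A, hA, hle⟩ := exists_integral_norm_le a b
  set μ := volume.restrict (Ico a b) with hμ
  set B : ℝ := (measureUnivNNReal μ : ℝ) ^ (2 : ENNReal).toReal⁻¹ with hB
  have hB0 : 0 ≤ B := Real.rpow_nonneg (NNReal.coe_nonneg _) _
  refine ⟨A * B, by positivity, fun K C hC hK hb => ?_⟩
  have hint : ∀ (h : L2 a b) (x : ℝ), Integrable (fun y => K x y * h y) μ := fun h x =>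
    (L2.integrable h).bdd_mul (c := C) (hK.comp measurable_prodMk_left).aestronglyMeasurable
      (ae_of_all _ fun y => hb x y)
  have hbd : ∀ (h : L2 a b) (x : ℝ), ‖∫ y, K x y * h y ∂μ‖ ≤ C * (A * ‖h‖) := by
    intro h x
    refine (norm_integral_le_of_norm_le (g := fun y => C * ‖h y‖)
      ((L2.integrable h).norm.const_mul C) (ae_of_all _ fun y => ?_)).trans ?_
    · rw [norm_mul]; gcongr; exact hb x y
    · rw [integral_const_mul]; gcongr; exact hle h
  have hmem : ∀ h : L2 a b, MemLp (fun x => ∫ y, K x y * h y ∂μ) 2 μ := fun h => by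
    refine MemLp.of_bound ?_ (C * (A * ‖h‖)) (ae_of_all _ (hbd h))
    have : AEStronglyMeasurable (fun z : ℝ × ℝ => K z.1 z.2 * h z.2) (μ.prod μ) :=
      hK.aestronglyMeasurable.mul (Lp.aestronglyMeasurable h).comp_snd
    exact this.integral_prod_right'
  let T₀ : L2 a b →ₗ[ℂ] L2 a b :=
    { toFun := fun h => (hmem h).toLp _
      map_add' := fun h h' => by
        rw [← MemLp.toLp_add (hmem h) (hmem h')]
        refine MemLp.toLp_congr _ _ (ae_of_all _ fun x => ?_)
        simp only [Pi.add_apply]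
        rw [← integral_add (hint h x) (hint h' x)]
        refine integral_congr_ae ?_
        filter_upwards [Lp.coeFn_add h h'] with y hy
        rw [hy, Pi.add_apply, mul_add]
      map_smul' := fun c h => by
        rw [RingHom.id_apply, ← MemLp.toLp_const_smul c (hmem h)]
        refine MemLp.toLp_congr _ _ (ae_of_all _ fun x => ?_)
        simp only [Pi.smul_apply, smul_eq_mul]
        rw [← integral_const_mul]
        refine integral_congr_ae ?_
        filter_upwards [Lp.coeFn_smul c h] with y hy
        rw [hy, Pi.smul_apply, smul_eq_mul]; ring }
  have hT₀ : ∀ h : L2 a b, ‖T₀ h‖ ≤ (C * (A * B)) * ‖h‖ := fun h => by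
    refine (Lp.norm_le_of_ae_bound (C := C * (A * ‖h‖)) (by positivity) ?_).trans_eq ?_
    · filter_upwards [(hmem h).coeFn_toLp] with x hx
      exact (congrArg norm hx).trans_le (hbd h x)
    · rw [← hB]; ring
  refine ⟨T₀.mkContinuous _ hT₀, fun h => ?_,
    LinearMap.mkContinuous_norm_le _ (by positivity) _⟩
  filter_upwards [(hmem h).coeFn_toLp] with x hx
  exact ⟨hint h x, hx⟩

lemma integrable_bilin {a b : ℝ} (φ ψ : L2 a b) {K : ℝ × ℝ → ℂ} {C : ℝ}
    (hK : AEStronglyMeasurable K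
      ((volume.restrict (Ico a b)).prod (volume.restrict (Ico a b))))
    (hb : ∀ᵐ z ∂((volume.restrict (Ico a b)).prod (volume.restrict (Ico a b))), ‖K z‖ ≤ C) :
    Integrable (fun z : ℝ × ℝ => K z * ((starRingEnd ℂ) (φ z.1) * ψ z.2))
      ((volume.restrict (Ico a b)).prod (volume.restrict (Ico a b))) := by
  have h1 : Integrable (fun x => (starRingEnd ℂ) (φ x)) (volume.restrict (Ico a b)) := by
    refine (L2.integrable φ).mono ?_ (ae_of_all _ fun x => by simp)
    exact Complex.continuous_conj.comp_aestronglyMeasurable (Lp.aestronglyMeasurable φ)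
  exact (h1.mul_prod (L2.integrable ψ)).bdd_mul hK hb

theorem inner_integralOperator {a b : ℝ} {K : ℝ → ℝ → ℂ} {C : ℝ}
    (hK : Measurable (Function.uncurry K)) (hb : ∀ x y, ‖K x y‖ ≤ C)
    {T : L2 a b →L[ℂ] L2 a b} (hT : IsIntegralOperator a b K T) (φ ψ : L2 a b) :
    inner ℂ φ (T ψ) = ∫ z : ℝ × ℝ, K z.1 z.2 * ((starRingEnd ℂ) (φ z.1) * ψ z.2)
      ∂((volume.restrict (Ico a b)).prod (volume.restrict (Ico a b))) := by
  rw [MeasureTheory.L2.inner_def, integral_prod]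
  · refine integral_congr_ae ?_
    filter_upwards [hT ψ] with x hx
    rw [RCLike.inner_apply, hx.2, mul_comm, ← integral_const_mul]
    refine integral_congr_ae (ae_of_all _ fun y => ?_)
    ring
  · exact integrable_bilin φ ψ (C := C) hK.aestronglyMeasurable (ae_of_all _ fun z => hb z.1 z.2)

/-! ### The discrete operators -/

/-- The representative of `chi a b N j`. -/
noncomputable def chiFun (a b : ℝ) (N j : ℕ) (x : ℝ) : ℂ :=
  (Ico (gridPoint a b N (j - 1)) (gridPoint a b N j)).indicator
    (fun _ => ((Real.sqrt ((N : ℝ) / (b - a)) : ℝ) : ℂ)) x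

lemma chi_ae_eq (a b : ℝ) (N j : ℕ) :
    (chi a b N j : ℝ → ℂ) =ᵐ[volume.restrict (Ico a b)] chiFun a b N j :=
  indicatorConstLp_coeFn

lemma measurable_chiFun (a b : ℝ) (N j : ℕ) : Measurable (chiFun a b N j) :=
  measurable_const.indicator measurableSet_Ico

lemma norm_chiFun_le (a b : ℝ) (N j : ℕ) (x : ℝ) :
    ‖chiFun a b N j x‖ ≤ ‖((Real.sqrt ((N : ℝ) / (b - a)) : ℝ) : ℂ)‖ :=
  norm_indicator_le_norm_self (fun _ => ((Real.sqrt ((N : ℝ) / (b - a)) : ℝ) : ℂ)) x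

section Grid

variable {a b : ℝ} (hab : a < b) {N : ℕ} (hN : 0 < N)
include hab hN

lemma mem_cell_iff {x : ℝ} (hx : x ∈ Ico a b) {j : ℕ} (hj : 1 ≤ j) :
    x ∈ Ico (gridPoint a b N (j - 1)) (gridPoint a b N j) ↔ j = gridIndex a b N x := by
  have hL : 0 < b - a := by linarith
  have hN' : (0 : ℝ) < N := by exact_mod_cast hN
  have h0 : 0 ≤ (x - a) / (b - a) * N :=
    mul_nonneg (div_nonneg (by linarith [hx.1]) hL.le) hN'.le
  have hle : ∀ i : ℕ, gridPoint a b N i ≤ x ↔ (i : ℝ) ≤ (x - a) / (b - a) * N := by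
    intro i
    rw [gridPoint, ← le_sub_iff_add_le', ← le_div_iff₀ hL, div_le_iff₀ hN']
  rw [mem_Ico, hle, ← not_le, hle, ← Nat.le_floor_iff h0, ← Nat.le_floor_iff h0, gridIndex]
  omega

lemma chiFun_eq {x : ℝ} (hx : x ∈ Ico a b) {j : ℕ} (hj : 1 ≤ j) :
    chiFun a b N j x
      = if j = gridIndex a b N x then ((Real.sqrt ((N : ℝ) / (b - a)) : ℝ) : ℂ) else 0 := by
  classical
  rw [chiFun, Set.indicator_apply, if_congr (mem_cell_iff hab hN hx hj) rfl rfl]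

lemma inner_chi {j k : ℕ} (hj : j ∈ Finset.Icc 1 N) (hk : k ∈ Finset.Icc 1 N) :
    inner ℂ (chi a b N j) (chi a b N k) = if j = k then 1 else 0 := by
  have hL : 0 < b - a := by linarith
  have hN' : (0 : ℝ) < N := by exact_mod_cast hN
  rw [Finset.mem_Icc] at hj hk
  rw [chi, chi, MeasureTheory.L2.inner_indicatorConstLp_indicatorConstLp]
  split_ifs with h
  · subst h
    have hsub : Ico (gridPoint a b N (j - 1)) (gridPoint a b N j) ⊆ Ico a b := by
      refine Ico_subset_Ico ?_ ?_
      · rw [gridPoint]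
        have : 0 ≤ ((j - 1 : ℕ) : ℝ) / N * (b - a) := by positivity
        linarith
      · rw [gridPoint]
        have : (j : ℝ) / N ≤ 1 := by
          rw [div_le_one hN']; exact_mod_cast hj.2
        nlinarith
    rw [inter_self, measureReal_restrict_apply measurableSet_Ico, inter_eq_left.2 hsub,
      Real.volume_real_Ico_of_le, RCLike.inner_apply, Complex.conj_ofReal, ← Complex.ofReal_mul,
      Real.mul_self_sqrt (by positivity), gridPoint, gridPoint, Nat.cast_sub hj.1,
      Complex.real_smul, ← Complex.ofReal_mul, ← Complex.ofReal_one]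
    · congr 1
      push_cast
      field_simp
      ring
    · simp only [gridPoint]
      gcongr
      omega
  · have : (volume.restrict (Ico a b)).real (Ico (gridPoint a b N (j - 1)) (gridPoint a b N j)
        ∩ Ico (gridPoint a b N (k - 1)) (gridPoint a b N k)) = 0 := by
      rw [measureReal_restrict_apply (measurableSet_Ico.inter measurableSet_Ico)]
      have : (Ico (gridPoint a b N (j - 1)) (gridPoint a b N j)
        ∩ Ico (gridPoint a b N (k - 1)) (gridPoint a b N k)) ∩ Ico a b = ∅ := by
        ext x
        simp only [mem_inter_iff, mem_empty_iff_false, iff_false]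
        rintro ⟨⟨h1, h2⟩, h3⟩
        exact h (((mem_cell_iff hab hN h3 hj.1).1 h1).trans
          ((mem_cell_iff hab hN h3 hk.1).1 h2).symm)
      rw [this]; simp
    rw [this, zero_smul]

theorem WN_eq (ν : ℂ) :
    WN a b ν N = 1 + ∑ s ∈ Finset.range (2 * N + 2), (((b - a) / N : ℝ) : ℂ) ^ (s + 1) •
      ∑ x ∈ Finset.Icc 1 N, ∑ y ∈ Finset.Icc 1 N, walkMatrix ν (Finset.Icc 1 N) s x y •
        InnerProductSpace.rankOne ℂ (chi a b N x) (chi a b N y) := by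
  rw [WN]
  refine orderedDoubleProd_expansion ν _ N _
    (fun u v => InnerProductSpace.rankOne ℂ (chi a b N u) (chi a b N v)) ?_ ?_
  · intro u _ v hv v' hv' w _
    rw [ContinuousLinearMap.mul_def, InnerProductSpace.rankOne_comp_rankOne,
      inner_chi hab hN hv hv']
    split_ifs <;> simp
  · exact fun u v y => walkSum_eq_zero ν N u v y

end Grid

/-! ### Kernels of the discrete terms and their limits. -/

/-- The kernel of the term of order `s + 1` in the expansion of `WN`. -/
noncomputable def discreteKernel (a b : ℝ) (ν : ℂ) (N s : ℕ) (z : ℝ × ℝ) : ℂ :=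
  ∑ j ∈ Finset.Icc 1 N, ∑ k ∈ Finset.Icc 1 N,
    (((b - a) / N : ℝ) : ℂ) ^ (s + 1) * walkMatrix ν (Finset.Icc 1 N) s j k *
      (chiFun a b N j z.1 * chiFun a b N k z.2)

lemma measurable_discreteKernel (a b : ℝ) (ν : ℂ) (N s : ℕ) :
    Measurable (discreteKernel a b ν N s) := by
  unfold discreteKernel
  refine Finset.measurable_fun_sum _ fun j _ => Finset.measurable_fun_sum _ fun k _ => ?_
  exact (((measurable_chiFun a b N j).comp measurable_fst).mul
    ((measurable_chiFun a b N k).comp measurable_snd)).const_mul _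

/-- Only the cell containing (x,y) contributes; there the product of the two indicators is N/(b-a),
which cancels one of the s + 1 powers of the step. -/
lemma discreteKernel_eq {a b : ℝ} (hab : a < b) {N : ℕ} (hN : 0 < N) (ν : ℂ) (s : ℕ) {x y : ℝ}
    (hx : x ∈ Ico a b) (hy : y ∈ Ico a b) :
    discreteKernel a b ν N s (x, y) = (((b - a) / N : ℝ) : ℂ) ^ s *
      walkMatrix ν (Finset.Icc 1 N) s (gridIndex a b N x) (gridIndex a b N y) := by
  have hL : 0 < b - a := by linarith
  have hN' : (0 : ℝ) < N := by exact_mod_cast hN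
  have hsq : ((Real.sqrt ((N : ℝ) / (b - a)) : ℝ) : ℂ) * ((Real.sqrt ((N : ℝ) / (b - a)) : ℝ) : ℂ)
      = (((N : ℝ) / (b - a) : ℝ) : ℂ) := by
    rw [← Complex.ofReal_mul, Real.mul_self_sqrt (by positivity)]
  rw [discreteKernel, Finset.sum_eq_single_of_mem _ (gridIndex_mem hx hN),
    Finset.sum_eq_single_of_mem _ (gridIndex_mem hy hN)]
  · rw [chiFun_eq hab hN hx (by simp [gridIndex]), chiFun_eq hab hN hy (by simp [gridIndex]),
      if_pos rfl, if_pos rfl, hsq, pow_succ]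
    have : (((b - a) / N : ℝ) : ℂ) * (((N : ℝ) / (b - a) : ℝ) : ℂ) = 1 := by
      rw [← Complex.ofReal_mul, ← Complex.ofReal_one]; congr 1; field_simp
    linear_combination (((b - a) / N : ℝ) : ℂ) ^ s *
      walkMatrix ν (Finset.Icc 1 N) s (gridIndex a b N x) (gridIndex a b N y) * this
  · intro k hk hne
    rw [chiFun_eq hab hN hy (Finset.mem_Icc.1 hk).1, if_neg hne]; simp
  · intro j hj hne
    refine Finset.sum_eq_zero fun k _ => ?_
    rw [chiFun_eq hab hN hx (Finset.mem_Icc.1 hj).1, if_neg hne]; simp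

/-- The bound for the kernels of order `s + 1`. -/
noncomputable def kernelBound (a b : ℝ) (ν : ℂ) (s : ℕ) : ℝ :=
  ‖ν‖ ^ (s + 1) * ((b - a) ^ s * 2 ^ s / ((s - 1).factorial : ℝ))

lemma kernelBound_nonneg {a b : ℝ} (hab : a < b) (ν : ℂ) (s : ℕ) : 0 ≤ kernelBound a b ν s := by
  have : 0 < b - a := by linarith
  unfold kernelBound; positivity

lemma summable_kernelBound (a b : ℝ) (ν : ℂ) : Summable (kernelBound a b ν) := by
  rw [← summable_nat_add_iff 1]
  have := (Real.summable_pow_div_factorial (‖ν‖ * (b - a) * 2)).mul_left (‖ν‖ ^ 2 * (b - a) * 2)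
  refine this.congr fun s => ?_
  simp only [kernelBound, Nat.add_sub_cancel, mul_pow]
  ring

lemma norm_discreteKernel_le {a b : ℝ} (hab : a < b) {N : ℕ} (hN : 0 < N) (ν : ℂ) (s : ℕ)
    {x y : ℝ} (hx : x ∈ Ico a b) (hy : y ∈ Ico a b) :
    ‖discreteKernel a b ν N s (x, y)‖ ≤ kernelBound a b ν s := by
  have hL : 0 < b - a := by linarith
  have hN' : (0 : ℝ) < N := by exact_mod_cast hN
  rw [discreteKernel_eq hab hN ν s hx hy, norm_mul, norm_pow, Complex.norm_real,
    Real.norm_of_nonneg (by positivity), div_pow]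
  calc _ ≤ (b - a) ^ s / (N : ℝ) ^ s *
        (‖ν‖ ^ (s + 1) * ((N : ℝ) ^ s * 2 ^ s / ((s - 1).factorial : ℝ))) := by
        gcongr; exact norm_walkMatrix_le ν N s _ _
    _ = _ := by rw [kernelBound]; field_simp

lemma tendsto_discreteKernel {a b : ℝ} (hab : a < b) (ν : ℂ) (s : ℕ) {x y : ℝ}
    (hx : x ∈ Ico a b) (hy : y ∈ Ico a b) (hxy : x ≠ y) :
    Tendsto (fun N => discreteKernel a b ν N s (x, y)) atTop (𝓝 (kernel a b ν (s + 1) x y)) := by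
  rw [kernel_eq_orderingSum a b ν s hx hy hxy]
  refine (tendsto_walkMatrix ν s hx hy hxy).congr' ?_
  filter_upwards [eventually_gt_atTop 0] with N hN
  rw [discreteKernel_eq hab hN ν s hx hy]

/-- The bound is inherited from the discrete kernels by passing to the limit, so no estimate of the
numbers `D` and `E` is needed. Elsewhere the kernel is zero. -/
lemma norm_kernel_le {a b : ℝ} (hab : a < b) (ν : ℂ) (s : ℕ) (x y : ℝ) :
    ‖kernel a b ν (s + 1) x y‖ ≤ kernelBound a b ν s := by
  by_cases h : x ∈ Ico a b ∧ y ∈ Ico a b ∧ x ≠ y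
  · refine le_of_tendsto (tendsto_discreteKernel hab ν s h.1 h.2.1 h.2.2).norm ?_
    filter_upwards [eventually_gt_atTop 0] with N hN
    exact norm_discreteKernel_le hab hN ν s h.1 h.2.1
  · rw [kernel, if_neg, if_neg]
    · simpa using kernelBound_nonneg hab ν s
    · rintro ⟨h1, h2, h3⟩
      exact h ⟨⟨h1.trans h2.le, h3⟩, ⟨h1, h2.trans h3⟩, h2.ne'⟩
    · rintro ⟨h1, h2, h3⟩
      exact h ⟨⟨h1, h2.trans h3⟩, ⟨h1.trans h2.le, h3⟩, h2.ne⟩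

lemma measurable_kernel (a b : ℝ) (ν : ℂ) (s : ℕ) :
    Measurable (Function.uncurry (kernel a b ν s)) := by
  classical
  have hbr : ∀ m n p, Measurable fun z : ℝ × ℝ => (bracket a b m n p z.1 z.2 : ℂ) := by
    intro m n p
    unfold bracket
    fun_prop
  have hbr' : ∀ m n p, Measurable fun z : ℝ × ℝ => (bracket a b m n p z.2 z.1 : ℂ) := by
    intro m n p
    unfold bracket
    fun_prop
  have hf : Measurable fun z : ℝ × ℝ => f a b ν s z.1 z.2 := by
    unfold f
    refine Finset.measurable_fun_sum _ fun m _ => Finset.measurable_fun_sum _ fun n _ =>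
      Finset.measurable_fun_sum _ fun p _ => ?_
    split_ifs
    · exact Finset.measurable_fun_sum _ fun q _ => (hbr m n p).const_mul _
    · exact measurable_const
  have hg : Measurable fun z : ℝ × ℝ => g a b ν s z.1 z.2 := by
    unfold g
    refine Finset.measurable_fun_sum _ fun m _ => Finset.measurable_fun_sum _ fun n _ =>
      Finset.measurable_fun_sum _ fun p _ => ?_
    split_ifs
    · exact Finset.measurable_fun_sum _ fun q _ => (hbr' m n p).const_mul _
    · exact measurable_const
  refine Measurable.add (Measurable.ite ?_ hf measurable_const)
    (Measurable.ite ?_ hg measurable_const)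
  · exact (measurableSet_le measurable_const measurable_fst).inter
      ((measurableSet_lt measurable_fst measurable_snd).inter
        (measurableSet_lt measurable_snd measurable_const))
  · exact (measurableSet_le measurable_const measurable_snd).inter
      ((measurableSet_lt measurable_snd measurable_fst).inter
        (measurableSet_lt measurable_fst measurable_const))

/-! ### Sesquilinear forms and weak convergence. -/

/-- The sesquilinear form of the integral operator with kernel `K`. -/
noncomputable def kernelForm (a b : ℝ) (K : ℝ × ℝ → ℂ) (φ ψ : L2 a b) : ℂ :=
  ∫ z : ℝ × ℝ, K z * ((starRingEnd ℂ) (φ z.1) * ψ z.2)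
    ∂((volume.restrict (Ico a b)).prod (volume.restrict (Ico a b)))

lemma inner_chi_right {a b : ℝ} (N j : ℕ) (φ : L2 a b) :
    inner ℂ φ (chi a b N j) = ∫ x in Ico a b, chiFun a b N j x * (starRingEnd ℂ) (φ x) := by
  rw [MeasureTheory.L2.inner_def]
  refine integral_congr_ae ?_
  filter_upwards [chi_ae_eq a b N j] with x hx
  rw [RCLike.inner_apply, hx]

lemma inner_chi_left {a b : ℝ} (N j : ℕ) (ψ : L2 a b) :
    inner ℂ (chi a b N j) ψ = ∫ x in Ico a b, chiFun a b N j x * ψ x := by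
  rw [MeasureTheory.L2.inner_def]
  refine integral_congr_ae ?_
  filter_upwards [chi_ae_eq a b N j] with x hx
  rw [RCLike.inner_apply, hx, mul_comm, chiFun, Set.indicator_apply]
  split_ifs <;> simp

lemma kernelForm_discreteKernel (a b : ℝ) (ν : ℂ) (N s : ℕ) (φ ψ : L2 a b) :
    kernelForm a b (discreteKernel a b ν N s) φ ψ
      = ∑ j ∈ Finset.Icc 1 N, ∑ k ∈ Finset.Icc 1 N,
          (((b - a) / N : ℝ) : ℂ) ^ (s + 1) * walkMatrix ν (Finset.Icc 1 N) s j k *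
            (inner ℂ φ (chi a b N j) * inner ℂ (chi a b N k) ψ) := by
  have hint : ∀ j k, Integrable (fun z : ℝ × ℝ => (chiFun a b N j z.1 * chiFun a b N k z.2) *
      ((starRingEnd ℂ) (φ z.1) * ψ z.2))
      ((volume.restrict (Ico a b)).prod (volume.restrict (Ico a b))) := fun j k => by
    refine integrable_bilin φ ψ (C := ‖((Real.sqrt ((N : ℝ) / (b - a)) : ℝ) : ℂ)‖
      * ‖((Real.sqrt ((N : ℝ) / (b - a)) : ℝ) : ℂ)‖) (((measurable_chiFun a b N j).comp measurable_fst).mul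
      ((measurable_chiFun a b N k).comp measurable_snd)).aestronglyMeasurable
      (ae_of_all _ fun z => ?_)
    rw [norm_mul]
    exact mul_le_mul (norm_chiFun_le a b N j z.1) (norm_chiFun_le a b N k z.2) (norm_nonneg _)
      (norm_nonneg _)
  have e : ∀ z : ℝ × ℝ, discreteKernel a b ν N s z * ((starRingEnd ℂ) (φ z.1) * ψ z.2)
      = ∑ j ∈ Finset.Icc 1 N, ∑ k ∈ Finset.Icc 1 N,
          (((b - a) / N : ℝ) : ℂ) ^ (s + 1) * walkMatrix ν (Finset.Icc 1 N) s j k *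
            ((chiFun a b N j z.1 * chiFun a b N k z.2) *
              ((starRingEnd ℂ) (φ z.1) * ψ z.2)) := by
    intro z
    simp only [discreteKernel, Finset.sum_mul, mul_assoc]
  simp only [kernelForm, e]
  rw [integral_finsetSum _ fun j _ => integrable_finsetSum _ fun k _ => (hint j k).const_mul _]
  refine Finset.sum_congr rfl fun j _ => ?_
  rw [integral_finsetSum _ fun k _ => (hint j k).const_mul _]
  refine Finset.sum_congr rfl fun k _ => ?_
  rw [integral_const_mul, inner_chi_right, inner_chi_left, ← integral_prod_mul]
  congr 1
  refine integral_congr_ae (ae_of_all _ fun z => ?_)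
  simp only
  ring

theorem inner_WN {a b : ℝ} (hab : a < b) {N : ℕ} (hN : 0 < N) (ν : ℂ) (φ ψ : L2 a b) :
    inner ℂ φ (WN a b ν N ψ) = inner ℂ φ ψ
      + ∑ s ∈ Finset.range (2 * N + 2), kernelForm a b (discreteKernel a b ν N s) φ ψ := by
  rw [WN_eq hab hN]
  simp only [kernelForm_discreteKernel, _root_.add_apply,
    one_apply_eq_self, _root_.sum_apply, _root_.smul_apply,
    InnerProductSpace.rankOne_apply, inner_add_right, inner_sum, inner_smul_right, Finset.mul_sum]
  congr 1
  refine Finset.sum_congr rfl fun s _ => Finset.sum_congr rfl fun j _ =>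
    Finset.sum_congr rfl fun k _ => ?_
  ring

/-- The diagonal, where the pointwise limit of the discrete kernels is not established, is a null
set. -/
lemma ae_mem_offDiag (a b : ℝ) :
    ∀ᵐ z ∂((volume.restrict (Ico a b)).prod (volume.restrict (Ico a b))),
      z.1 ∈ Ico a b ∧ z.2 ∈ Ico a b ∧ z.1 ≠ z.2 := by
  rw [Measure.ae_prod_iff_ae_ae]
  · filter_upwards [ae_restrict_mem measurableSet_Ico] with x hx
    filter_upwards [ae_restrict_mem measurableSet_Ico,
      Measure.ae_ne (volume.restrict (Ico a b)) x] with y hy hne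
    exact ⟨hx, hy, hne.symm⟩
  · exact (measurable_fst measurableSet_Ico).inter ((measurable_snd measurableSet_Ico).inter
      (measurableSet_eq_fun measurable_fst measurable_snd).compl)

lemma norm_kernelForm_le {a b : ℝ} {K : ℝ × ℝ → ℂ} {C : ℝ}
    (hb : ∀ᵐ z ∂((volume.restrict (Ico a b)).prod (volume.restrict (Ico a b))), ‖K z‖ ≤ C)
    (φ ψ : L2 a b) :
    ‖kernelForm a b K φ ψ‖ ≤ C * ∫ z : ℝ × ℝ, ‖φ z.1‖ * ‖ψ z.2‖
      ∂((volume.restrict (Ico a b)).prod (volume.restrict (Ico a b))) := by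
  rw [← integral_const_mul]
  refine norm_integral_le_of_norm_le
    (((L2.integrable φ).norm.mul_prod (L2.integrable ψ).norm).const_mul C) ?_
  filter_upwards [hb] with z hz
  rw [norm_mul, norm_mul, RCLike.norm_conj]
  gcongr

lemma tendsto_kernelForm {a b : ℝ} (hab : a < b) (ν : ℂ) (s : ℕ) (φ ψ : L2 a b) :
    Tendsto (fun N => kernelForm a b (discreteKernel a b ν N s) φ ψ) atTop
      (𝓝 (kernelForm a b (fun z => kernel a b ν (s + 1) z.1 z.2) φ ψ)) := by
  refine tendsto_integral_filter_of_dominated_convergence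
    (fun z => kernelBound a b ν s * (‖φ z.1‖ * ‖ψ z.2‖)) ?_ ?_ ?_ ?_
  · filter_upwards [eventually_gt_atTop 0] with N hN
    refine (integrable_bilin φ ψ (C := kernelBound a b ν s)
      (measurable_discreteKernel a b ν N s).aestronglyMeasurable ?_).aestronglyMeasurable
    filter_upwards [ae_mem_offDiag a b] with z hz
    exact norm_discreteKernel_le hab hN ν s hz.1 hz.2.1
  · filter_upwards [eventually_gt_atTop 0] with N hN
    filter_upwards [ae_mem_offDiag a b] with z hz
    rw [norm_mul, norm_mul, RCLike.norm_conj]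
    gcongr
    exact norm_discreteKernel_le hab hN ν s hz.1 hz.2.1
  · exact ((L2.integrable φ).norm.mul_prod (L2.integrable ψ).norm).const_mul _
  · filter_upwards [ae_mem_offDiag a b] with z hz
    exact (tendsto_discreteKernel hab ν s hz.1 hz.2.1 hz.2.2).mul_const _

theorem tendsto_inner_WN {a b : ℝ} (hab : a < b) (ν : ℂ) (φ ψ : L2 a b) :
    Tendsto (fun N => inner ℂ φ (WN a b ν N ψ)) atTop (𝓝 (inner ℂ φ ψ
      + ∑' s : ℕ, kernelForm a b (fun z => kernel a b ν (s + 1) z.1 z.2) φ ψ)) := by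
  classical
  -- The finite expansion is written as a series cut off at 2N + 2, so that dominated convergence
  -- for series applies; each fixed s is eventually below the cutoff.
  have h : Tendsto (fun N => ∑' s : ℕ, if s ∈ Finset.range (2 * N + 2) then
      kernelForm a b (discreteKernel a b ν N s) φ ψ else 0) atTop
      (𝓝 (∑' s : ℕ, kernelForm a b (fun z => kernel a b ν (s + 1) z.1 z.2) φ ψ)) := by
    refine tendsto_tsum_of_dominated_convergence
      ((summable_kernelBound a b ν).mul_right (∫ z : ℝ × ℝ, ‖φ z.1‖ * ‖ψ z.2‖
        ∂((volume.restrict (Ico a b)).prod (volume.restrict (Ico a b))))) (fun s => ?_) ?_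
    · refine (tendsto_kernelForm hab ν s φ ψ).congr' ?_
      filter_upwards [eventually_ge_atTop s] with N hN
      rw [if_pos (by rw [Finset.mem_range]; omega)]
    · filter_upwards [eventually_gt_atTop 0] with N hN s
      have hs : ‖kernelForm a b (discreteKernel a b ν N s) φ ψ‖ ≤ _ :=
        norm_kernelForm_le (C := kernelBound a b ν s) (by
          filter_upwards [ae_mem_offDiag a b] with z hz
          exact norm_discreteKernel_le hab hN ν s hz.1 hz.2.1) φ ψ
      split_ifs
      · exact hs
      · rw [norm_zero]; exact (norm_nonneg _).trans hs
  refine (h.const_add (inner ℂ φ ψ)).congr' ?_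
  filter_upwards [eventually_gt_atTop 0] with N hN
  rw [inner_WN hab hN, tsum_eq_sum (s := Finset.range (2 * N + 2)) (fun s hs => if_neg hs)]
  congr 1
  exact Finset.sum_congr rfl fun s hs => if_pos hs

end CausalProduct

theorem theorem4 (a b : ℝ) (hab : a < b) (ν : ℂ) :
    ∃ (w : ℕ → CausalProduct.L2 a b →L[ℂ] CausalProduct.L2 a b)
      (W : CausalProduct.L2 a b →L[ℂ] CausalProduct.L2 a b),
      (∀ s : ℕ, 1 ≤ s →
        CausalProduct.IsIntegralOperator a b (CausalProduct.kernel a b ν s) (w s)) ∧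
      HasSum (fun s : ℕ => w (s + 1)) (W - 1) ∧
      Tendsto (fun N : ℕ => ContinuousLinearMapWOT.ofCLM (CausalProduct.WN a b ν N)) atTop
        (𝓝 (ContinuousLinearMapWOT.ofCLM W)) := by
  obtain ⟨A, hA, hop⟩ := CausalProduct.exists_isIntegralOperator a b
  choose T hT hTn using fun s : ℕ => hop (CausalProduct.kernel a b ν (s + 1))
    (CausalProduct.kernelBound a b ν s) (CausalProduct.kernelBound_nonneg hab ν s)
    (CausalProduct.measurable_kernel a b ν (s + 1)) (CausalProduct.norm_kernel_le hab ν s)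
  have hsum : Summable T :=
    Summable.of_norm_bounded ((CausalProduct.summable_kernelBound a b ν).mul_right A) hTn
  -- `T s` carries the kernel of index s + 1, hence the shift; the value at index 0 is immaterial.
  refine ⟨fun s => T (s - 1), 1 + ∑' s, T s, ?_, ?_, ?_⟩
  · intro s hs
    obtain ⟨t, rfl⟩ : ∃ t, s = t + 1 := ⟨s - 1, by omega⟩
    exact hT t
  · simpa using hsum.hasSum
  · rw [ContinuousLinearMapWOT.tendsto_iff_forall_inner_apply_tendsto]
    intro ψ φ
    have h := CausalProduct.tendsto_inner_WN hab ν φ ψ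
    have e : ∑' s : ℕ, CausalProduct.kernelForm a b
        (fun z => CausalProduct.kernel a b ν (s + 1) z.1 z.2) φ ψ
        = inner ℂ φ ((∑' s, T s) ψ) := by
      have h1 : HasSum (fun s => T s ψ) ((∑' s, T s) ψ) :=
        hsum.hasSum.mapL (ContinuousLinearMap.apply ℂ (CausalProduct.L2 a b) ψ)
      have h2 : HasSum (fun s => inner ℂ φ (T s ψ)) (inner ℂ φ ((∑' s, T s) ψ)) :=
        h1.mapL (innerSL ℂ φ)
      rw [← h2.tsum_eq]
      exact tsum_congr fun s => (CausalProduct.inner_integralOperator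
        (CausalProduct.measurable_kernel a b ν (s + 1)) (CausalProduct.norm_kernel_le hab ν s)
        (hT s) φ ψ).symm
    rw [e, ← inner_add_right] at h
    exact h
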